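/- Let $R>0$, $\Omega=(-R,R)$ and let $x_0\in\mathbb R$ be such that $I_0:=(x_0-1,x_0+1)\subset\subset\Omega$, i.e. $\overline{I_0}\subset\Omega$. Let $e^{t\Delta_\Omega}$ denote the Dirichlet heat semigroup on $\Omega$ and $e^{t\Delta_{\mathbb R}}$ the heat semigroup on $\mathbb R$: for $\phi\in L^\infty(\mathbb R)$ and $t>0$, $$\bigl(e^{t\Delta_\Omega}\phi\bigr)(x)=\sum_{k\ge 1}e^{-\mu_k t}\Bigl(\int_{\Omega}\phi\, e_k\,dy\Bigr)e_k(x)\quad (x\in[-R,R]),\qquad \bigl(e^{t\Delta_{\mathbb R}}\phi\bigr)(x)=\int_{\mathbb R}\frac{e^{-(x-y)^2/(4t)}}{\sqrt{4\pi t}}\,\phi(y)\,dy\quad(x\in\mathbb R),$$ where $\mu_k=\bigl(\tfrac{k\pi}{2R}\bigr)^2$ and $e_k(x)=R^{-1/2}\sin\bigl(\tfrac{k\pi(x+R)}{2R}\bigr)$, $k\ge1$, are the eigenvalues and the $L^2(\Omega)$-orthonormal eigenfunctions of $-\tfrac{d^2}{dx^2}$ on $\Omega$ with zero Dirichlet boundary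 conditions. Let $\phi\in L^\infty(\mathbb R)$ be nonnegative, symmetric with respect to $x_0$, nonincreasing in $|x-x_0|$, and supported in $I_0$ (all up to null sets). Then, for all $t>0$, $$\bigl(e^{t\Delta_\Omega}\phi\bigr)(x)\ \ge\ e^{-\lambda_\ell t}\Bigl[1-e^{-d_1(R-x)/t}\Bigr]\bigl(e^{t\Delta_{\mathbb R}}\phi\bigr)(x),\qquad x_0\le x\le R,$$ and $$\bigl(e^{t\Delta_\Omega}\phi\bigr)(x)\ \ge\ e^{-\lambda_\ell t}\Bigl[1-e^{-d_2(R+x)/t}\Bigr]\bigl(e^{t\Delta_{\mathbb R}}\phi\bigr)(x),\qquad -R\le x\le x_0,$$ where $\ell=R-|x_0|$, $d_1=R-x_0-1$, $d_2=R+x_0-1$ and $\lambda_\ell=\bigl(\tfrac{\pi}{2\ell}\bigr)^2$. -/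

import Mathlib

open MeasureTheory Set
open scoped ENNReal

noncomputable section

/-- The `k`-th eigenvalue (`k = 0, 1, 2, …`) of the Dirichlet realisation of `-d²/dx²` on the
interval `(a, b)`. -/
def dirichletEigenvalue (a b : ℝ) (k : ℕ) : ℝ :=
  ((k + 1) * Real.pi / (b - a)) ^ 2

/-- The `L²(a, b)`-normalised eigenfunction of the Dirichlet realisation of `-d²/dx²` on `(a, b)`
for the eigenvalue `dirichletEigenvalue a b k`; these form an orthonormal basis of `L²(a, b)`. -/
def dirichletEigenfunction (a b : ℝ) (k : ℕ) (x : ℝ) : ℝ :=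
  Real.sqrt (2 / (b - a)) * Real.sin ((k + 1) * Real.pi * (x - a) / (b - a))

/-- The Dirichlet heat semigroup `(e^{tΔ_Ω} φ)(x)` on the interval `Ω = (a, b)`, for `t > 0` and
`x ∈ [a, b]`, i.e. the exponential of the Dirichlet Laplacian, given by the spectral expansion
`∑ₖ e^{-λₖ t} ⟨φ, eₖ⟩ eₖ(x)`. For `t > 0` and bounded `φ` the series converges absolutely and
uniformly, and gives the continuous representative on `[a, b]`. -/
def dirichletHeat (a b t : ℝ) (φ : ℝ → ℝ) (x : ℝ) : ℝ :=
  ∑' k : ℕ, Real.exp (-dirichletEigenvalue a b k * t) *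
    (∫ y in Ioo a b, φ y * dirichletEigenfunction a b k y) * dirichletEigenfunction a b k x

/-- The heat semigroup `(e^{tΔ_ℝ} φ)(x)` on the real line, for `t > 0`: convolution with the
Gauss kernel. -/
def lineHeat (t : ℝ) (φ : ℝ → ℝ) (x : ℝ) : ℝ :=
  ∫ y, (4 * Real.pi * t) ^ (-(1 / 2) : ℝ) * Real.exp (-(x - y) ^ 2 / (4 * t)) * φ y

/-- The eigenfunctions vanish at both end points. -/
theorem dirichletEigenfunction_boundary {a b : ℝ} (hab : a < b) (k : ℕ) :
    dirichletEigenfunction a b k a = 0 ∧ dirichletEigenfunction a b k b = 0 := by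
  have h : b - a ≠ 0 := (sub_pos.2 hab).ne'
  refine ⟨by simp [dirichletEigenfunction], ?_⟩
  have h2 : ((k : ℝ) + 1) * Real.pi * (b - a) / (b - a) = ((k + 1 : ℕ) : ℝ) * Real.pi := by
    push_cast
    field_simp
  rw [dirichletEigenfunction, h2, Real.sin_nat_mul_pi, mul_zero]

/-- The eigenvalue equation `-e'' = λ e`. -/
theorem dirichletEigenfunction_deriv (a b : ℝ) (k : ℕ) (x : ℝ) :
    -deriv (deriv (dirichletEigenfunction a b k)) x
      = dirichletEigenvalue a b k * dirichletEigenfunction a b k x := by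
  have hl (y : ℝ) : HasDerivAt (fun x : ℝ => ((k : ℝ) + 1) * Real.pi * (x - a) / (b - a))
      (((k : ℝ) + 1) * Real.pi / (b - a)) y := by
    simpa using (((hasDerivAt_id y).sub_const a).const_mul (((k : ℝ) + 1) * Real.pi)).div_const
      (b - a)
  have h1 : deriv (dirichletEigenfunction a b k) = fun y => Real.sqrt (2 / (b - a)) *
      (Real.cos (((k : ℝ) + 1) * Real.pi * (y - a) / (b - a)) *
        (((k : ℝ) + 1) * Real.pi / (b - a))) := by
    funext y
    exact ((hl y).sin.const_mul _).deriv
  rw [h1, (((hl x).cos.mul_const _).const_mul _).deriv]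
  simp only [dirichletEigenvalue, dirichletEigenfunction]
  ring

/-- The spectral expansion converges for positive times. -/
theorem summable_dirichletHeat {a b t : ℝ} (hab : a < b) (ht : 0 < t) {φ : ℝ → ℝ}
    (hφ : MemLp φ ∞ volume) (x : ℝ) :
    Summable fun k : ℕ => Real.exp (-dirichletEigenvalue a b k * t) *
      (∫ y in Ioo a b, φ y * dirichletEigenfunction a b k y) * dirichletEigenfunction a b k x := by
  set s := Real.sqrt (2 / (b - a)) with hs
  have hs0 : 0 ≤ s := Real.sqrt_nonneg _
  have he (k : ℕ) (y : ℝ) : |dirichletEigenfunction a b k y| ≤ s := by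
    rw [dirichletEigenfunction, abs_mul, abs_of_nonneg hs0]
    exact mul_le_of_le_one_right hs0 (Real.abs_sin_le_one _)
  have hint : Integrable φ (volume.restrict (Ioo a b)) :=
    (hφ.restrict (Ioo a b)).integrable le_top
  set M := ∫ y in Ioo a b, |φ y| * s with hM
  have hM0 : 0 ≤ M := integral_nonneg fun y => mul_nonneg (abs_nonneg _) hs0
  have hc (k : ℕ) : |∫ y in Ioo a b, φ y * dirichletEigenfunction a b k y| ≤ M := by
    rw [← Real.norm_eq_abs]
    refine norm_integral_le_of_norm_le (hint.abs.mul_const s) (Filter.Eventually.of_forall fun y => ?_)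
    rw [Real.norm_eq_abs, abs_mul]
    exact mul_le_mul_of_nonneg_left (he k y) (abs_nonneg _)
  set c := (Real.pi / (b - a)) ^ 2 * t with hcdef
  have hc0 : 0 < c := by
    have := sub_pos.2 hab
    positivity
  have hgeo : Summable fun k : ℕ => Real.exp (-c) ^ k :=
    summable_geometric_of_lt_one (Real.exp_pos _).le (by rw [← Real.exp_zero]; exact Real.exp_lt_exp.2 (by linarith))
  refine Summable.of_norm_bounded (g := fun k : ℕ => Real.exp (-c) ^ k * (M * s))
    (hgeo.mul_right _) fun k => ?_
  rw [Real.norm_eq_abs, abs_mul, abs_mul, Real.abs_exp, mul_assoc]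
  refine mul_le_mul ?_ (mul_le_mul (hc k) (he k x) (abs_nonneg _) hM0)
    (by positivity) (by positivity)
  rw [← Real.exp_nat_mul, Real.exp_le_exp]
  have h1 : -dirichletEigenvalue a b k * t = -(((k : ℝ) + 1) ^ 2 * c) := by
    simp only [dirichletEigenvalue, hcdef]
    ring
  rw [h1]
  have hk : (0 : ℝ) ≤ k := Nat.cast_nonneg k
  nlinarith [mul_nonneg hc0.le (sq_nonneg (k : ℝ)), mul_nonneg hc0.le hk]

end

/-! The bound is proved at the centre `x₀` and then carried to `[x₀, R]` by comparison; reflection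
gives the other side.

At the centre, use the interval `(x₀ - ℓ, x₀ + ℓ)` inside `(-R, R)`. By the method of images, its
kernel at `x₀` is the Gauss kernel times an alternating theta series in `|y - x₀|`
(`dirichletKernel_center`). The Jacobi triple product shows that this factor is nonnegative and
decreasing (`altTheta_antitone`). Since `φ` decreases as well, Chebyshev's inequality bounds the
Dirichlet flow at `x₀` below by the free flow times the survival probability. Testing the kernel
against the ground state, which peaks at `x₀`, shows that this probability is at least `e^{-λt}`
(`exp_mul_lineHeat_le_dirichletHeat_center`). Enlarging the domain to `(-R, R)` only increases the
flow.

On `[x₀, R]`, compare the flow on `(-R, R)` with `e^{-λt}` times the flow on `(-(R + n), R)`. The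
latter is a subsolution that vanishes at `R` and is controlled at `x₀` by the previous step, because
it lies below the free flow. As `n → ∞` it becomes the half-line flow, with kernel `G(x - y) - G(x +
y - 2R) = G(x - y)(1 - e^{-(R-x)(R-y)/t})`, where `G` is the Gauss kernel; the inequality `y ≤ x₀ +
1` on the support produces `d₁`. -/

open Filter Topology

/-! ### The parabolic minimum principle. -/

/-- The second derivative is nonnegative at a local minimum. -/
theorem IsLocalMin.second_deriv_nonneg {f f' : ℝ → ℝ} {x f'' : ℝ} (hmin : IsLocalMin f x)
    (hf : ∀ᶠ y in 𝓝 x, HasDerivAt f (f' y) y) (hf' : HasDerivAt f' f'' x) : 0 ≤ f'' := by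
  by_contra! hneg
  have hd : deriv f =ᶠ[𝓝 x] f' := hf.mono fun y hy => hy.deriv
  have hdd : deriv (deriv f) x = f'' := by rw [hd.deriv_eq, hf'.deriv]
  have h0 : deriv f x = 0 := hmin.deriv_eq_zero
  -- A negative second derivative would make `x` a local maximum too, so `f` would be locally
  -- constant and `f''` would vanish.
  have hmax : IsLocalMax f x :=
    isLocalMax_of_deriv_deriv_neg (by rw [hdd]; exact hneg) h0 hf.self_of_nhds.continuousAt
  have hconst : f =ᶠ[𝓝 x] fun _ => f x := by
    filter_upwards [hmin, hmax] with y h1 h2 using le_antisymm h2 h1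
  have hd0 : deriv f =ᶠ[𝓝 x] fun _ => (0 : ℝ) := by
    filter_upwards [hconst.eventuallyEq_nhds] with y hy
    rw [hy.deriv_eq, deriv_const]
  rw [hd0.deriv_eq, deriv_const] at hdd
  exact hneg.ne hdd.symm

/-- A derivative is nonpositive at a point where a minimum from the left is attained. -/
theorem HasDerivAt.nonpos_of_left_min {f : ℝ → ℝ} {x f' τ : ℝ} (hτ : τ < x)
    (hf : HasDerivAt f f' x) (hmin : ∀ y ∈ Ioo τ x, f x ≤ f y) : f' ≤ 0 := by
  have h1 : Tendsto (slope f x) (𝓝[<] x) (𝓝 f') :=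
    (hasDerivAt_iff_tendsto_slope.1 hf).mono_left (nhdsWithin_mono _ fun y hy => ne_of_lt hy)
  refine le_of_tendsto h1 ?_
  filter_upwards [Ioo_mem_nhdsLT hτ] with y hy
  rw [slope_def_field]
  exact div_nonpos_of_nonneg_of_nonpos (sub_nonneg.2 (hmin y hy)) (sub_nonpos.2 hy.2.le)

/-- The weak minimum principle for supersolutions of the heat equation on a bounded interval,
with the initial condition understood as a uniform lower limit. -/
theorem parabolic_minimum_principle {a b : ℝ} {W Wt Wx Wxx : ℝ → ℝ → ℝ}
    (hcont : ContinuousOn (Function.uncurry W) (Ioi 0 ×ˢ Icc a b))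
    (ht : ∀ t, 0 < t → ∀ x ∈ Ioo a b, HasDerivAt (fun s => W s x) (Wt t x) t)
    (hx : ∀ t, 0 < t → ∀ x ∈ Ioo a b, HasDerivAt (W t) (Wx t x) x)
    (hxx : ∀ t, 0 < t → ∀ x ∈ Ioo a b, HasDerivAt (Wx t) (Wxx t x) x)
    (hpde : ∀ t, 0 < t → ∀ x ∈ Ioo a b, Wxx t x ≤ Wt t x)
    (ha : ∀ t, 0 < t → 0 ≤ W t a) (hb : ∀ t, 0 < t → 0 ≤ W t b)
    (hinit : ∀ ε, 0 < ε → ∃ τ, 0 < τ ∧ ∀ t ∈ Ioo 0 τ, ∀ x ∈ Icc a b, -ε ≤ W t x)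
    {t x : ℝ} (ht0 : 0 < t) (hxab : x ∈ Icc a b) : 0 ≤ W t x := by
  by_contra! hneg
  obtain ⟨m, hm, hm0⟩ : ∃ m, W t x = -m ∧ 0 < m := ⟨-W t x, by ring, by linarith⟩
  obtain ⟨τ, hτ, hini⟩ := hinit (m / 2) (by positivity)
  set r := min τ t / 2 with hr
  have hr0 : 0 < r := by positivity
  have hrτ : r < τ := by have := min_le_left τ t; have : 0 < min τ t := by positivity
                         linarith
  have hrt : r < t := by have := min_le_right τ t; have : 0 < min τ t := by positivity
                         linarith
  -- The penalty `δ (s - r)` makes the supersolution strict. It is at most `m / 4` up to time `t`,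
  -- so the minimum of `V` is at most `-3m/4`. This lies below the initial bound `-m/2` and below
  -- the lateral bound `0`, which excludes the parabolic boundary.
  set δ := m / (4 * t) with hδ
  have hδ0 : 0 < δ := by positivity
  have hδt : δ * t = m / 4 := by rw [hδ]; field_simp
  set V : ℝ × ℝ → ℝ := fun p => W p.1 p.2 + δ * (p.1 - r) with hV
  have hVc : ContinuousOn V (Icc r t ×ˢ Icc a b) := by
    refine ContinuousOn.add (hcont.mono ?_) (by fun_prop)
    exact prod_mono (fun s hs => hr0.trans_le hs.1) le_rfl
  obtain ⟨⟨s, y⟩, ⟨hs, hy⟩, hmin⟩ := (isCompact_Icc.prod isCompact_Icc).exists_isMinOn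
    ⟨(t, x), ⟨right_mem_Icc.2 hrt.le, hxab⟩⟩ hVc
  have hmin' : ∀ s' ∈ Icc r t, ∀ y' ∈ Icc a b,
      W s y + δ * (s - r) ≤ W s' y' + δ * (s' - r) := fun s' hs' y' hy' =>
    isMinOn_iff.1 hmin (s', y') ⟨hs', hy'⟩
  have hs0 : 0 < s := hr0.trans_le hs.1
  have hbound : W s y + δ * (s - r) ≤ -m + m / 4 := by
    have := hmin' t (right_mem_Icc.2 hrt.le) x hxab
    rw [hm] at this
    nlinarith
  have hδs : 0 ≤ δ * (s - r) := mul_nonneg hδ0.le (sub_nonneg.2 hs.1)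
  have hsr : r < s := by
    refine lt_of_le_of_ne hs.1 fun h => ?_
    have := hini s ⟨hs0, h ▸ hrτ⟩ y hy
    linarith
  have hya : a < y := by
    refine lt_of_le_of_ne hy.1 fun h => ?_
    have := ha s hs0
    rw [h] at this
    linarith
  have hyb : y < b := by
    refine lt_of_le_of_ne hy.2 fun h => ?_
    have := hb s hs0
    rw [← h] at this
    linarith
  have hyab : y ∈ Ioo a b := ⟨hya, hyb⟩
  have h1 : 0 ≤ Wxx s y := by
    refine IsLocalMin.second_deriv_nonneg (f := W s) (f' := Wx s) (x := y) ?_ ?_ (hxx s hs0 y hyab)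
    · filter_upwards [Icc_mem_nhds hya hyb] with y' hy'
      have := hmin' s hs y' hy'
      linarith
    · filter_upwards [Ioo_mem_nhds hya hyb] with y' hy' using hx s hs0 y' hy'
  -- Only earlier times are compared, because the minimum may occur at the final time.
  have h2 : Wt s y + δ * 1 ≤ 0 := by
    refine HasDerivAt.nonpos_of_left_min (f := fun s => W s y + δ * (s - r)) hsr
      ((ht s hs0 y hyab).add (((hasDerivAt_id s).sub_const r).const_mul δ)) fun s' hs' => ?_
    exact hmin' s' ⟨hs'.1.le, hs'.2.le.trans hs.2⟩ y hy
  have := hpde s hs0 y hyab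
  linarith

/-! ### The spectral expansion as a classical solution. -/

/-- A function of `(t, x)` that is jointly continuous for positive times and solves the heat
equation there. -/
def IsHeatSolution (W : ℝ → ℝ → ℝ) : Prop :=
  ContinuousOn (Function.uncurry W) (Ioi 0 ×ˢ univ) ∧
    ∃ Wx Wxx : ℝ → ℝ → ℝ, ∀ t, 0 < t → ∀ x, HasDerivAt (W t) (Wx t x) x ∧
      HasDerivAt (Wx t) (Wxx t x) x ∧ HasDerivAt (fun s => W s x) (Wxx t x) t

/-- Since `(k + 1)² ≥ k + 1`, the Gaussian factor is dominated by a geometric one. This is the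
majorant for differentiating sine series term by term. -/
theorem summable_pow_mul_exp_neg_sq (n : ℕ) {ω τ : ℝ} (hω : 0 < ω) (hτ : 0 < τ) :
    Summable fun k : ℕ => (((k : ℝ) + 1) * ω) ^ n * Real.exp (-(((k : ℝ) + 1) * ω) ^ 2 * τ) := by
  have h0 : Summable fun k : ℕ => (k : ℝ) ^ n * Real.exp (-(ω ^ 2 * τ)) ^ k :=
    summable_pow_mul_geometric_of_norm_lt_one n (by
      rw [Real.norm_eq_abs, Real.abs_exp, ← Real.exp_zero]
      exact Real.exp_lt_exp.2 (by have : 0 < ω ^ 2 * τ := by positivity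
                                  linarith))
  have h1 := ((summable_nat_add_iff 1).2 h0).mul_left (ω ^ n)
  refine Summable.of_nonneg_of_le (fun k => by positivity) (fun k => ?_) h1
  push_cast
  rw [mul_pow, mul_comm (_ ^ n) (ω ^ n), mul_assoc]
  refine mul_le_mul_of_nonneg_left (mul_le_mul_of_nonneg_left ?_ (by positivity)) (by positivity)
  rw [← Real.exp_nat_mul, Real.exp_le_exp]
  push_cast
  have hk : (0 : ℝ) ≤ k := Nat.cast_nonneg k
  have h2 : 0 < ω ^ 2 * τ := by positivity
  nlinarith [mul_nonneg h2.le hk, mul_nonneg h2.le (sq_nonneg (k : ℝ))]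

/-- A sine series with bounded coefficients, damped by the heat factors, solves the heat
equation. -/
theorem isHeatSolution_sine_series {c : ℕ → ℝ} {M ω a : ℝ} (hω : 0 < ω) (hc : ∀ k, |c k| ≤ M) :
    IsHeatSolution fun t x => ∑' k : ℕ, c k *
      (Real.exp (-(((k : ℝ) + 1) * ω) ^ 2 * t) * Real.sin (((k : ℝ) + 1) * ω * (x - a))) := by
  have hM : 0 ≤ M := (abs_nonneg _).trans (hc 0)
  -- Here `θ` stands for a sine or cosine value and `n` for the order of the space derivative. The
  -- bound is uniform in times `≥ τ`; taking `τ = t / 2` gives continuity and the time derivative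
  -- near `t`.
  have key : ∀ (n : ℕ) (τ t θ : ℝ) (_ : 0 < τ) (_ : τ ≤ t) (_ : |θ| ≤ 1) (k : ℕ),
      ‖c k * ((((k : ℝ) + 1) * ω) ^ n * Real.exp (-(((k : ℝ) + 1) * ω) ^ 2 * t) * θ)‖ ≤
        M * ((((k : ℝ) + 1) * ω) ^ n * Real.exp (-(((k : ℝ) + 1) * ω) ^ 2 * τ)) := by
    intro n τ t θ hτ hτt hθ k
    have hp : 0 ≤ (((k : ℝ) + 1) * ω) ^ n := by positivity
    rw [Real.norm_eq_abs, abs_mul, abs_mul, abs_mul, Real.abs_exp, abs_of_nonneg hp]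
    refine mul_le_mul (hc k) ?_ (by positivity) hM
    refine (mul_le_of_le_one_right (by positivity) hθ).trans ?_
    refine mul_le_mul_of_nonneg_left (Real.exp_le_exp.2 ?_) hp
    nlinarith [sq_nonneg (((k : ℝ) + 1) * ω)]
  have hs : ∀ (n : ℕ) (τ : ℝ), 0 < τ → Summable fun k : ℕ =>
      M * ((((k : ℝ) + 1) * ω) ^ n * Real.exp (-(((k : ℝ) + 1) * ω) ^ 2 * τ)) :=
    fun n τ hτ => (summable_pow_mul_exp_neg_sq n hω hτ).mul_left M
  have hsin : ∀ (k : ℕ) (x : ℝ), HasDerivAt (fun x => Real.sin (((k : ℝ) + 1) * ω * (x - a)))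
      (((k : ℝ) + 1) * ω * Real.cos (((k : ℝ) + 1) * ω * (x - a))) x := fun k x => by
    have := (((hasDerivAt_id x).sub_const a).const_mul (((k : ℝ) + 1) * ω)).sin
    simpa [mul_comm] using this
  have hcos : ∀ (k : ℕ) (x : ℝ), HasDerivAt (fun x => Real.cos (((k : ℝ) + 1) * ω * (x - a)))
      (-(((k : ℝ) + 1) * ω * Real.sin (((k : ℝ) + 1) * ω * (x - a)))) x := fun k x => by
    have := (((hasDerivAt_id x).sub_const a).const_mul (((k : ℝ) + 1) * ω)).cos
    simpa [mul_comm] using this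
  refine ⟨?_, fun t x => ∑' k : ℕ, c k * ((((k : ℝ) + 1) * ω) ^ 1 *
      Real.exp (-(((k : ℝ) + 1) * ω) ^ 2 * t) * Real.cos (((k : ℝ) + 1) * ω * (x - a))),
    fun t x => ∑' k : ℕ, c k * ((((k : ℝ) + 1) * ω) ^ 2 *
      Real.exp (-(((k : ℝ) + 1) * ω) ^ 2 * t) * -Real.sin (((k : ℝ) + 1) * ω * (x - a))),
    fun t ht x => ⟨?_, ?_, ?_⟩⟩
  · rintro ⟨t, x⟩ ⟨ht, -⟩
    have ht : 0 < t := ht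
    have h1 : ContinuousOn (fun p : ℝ × ℝ => ∑' k : ℕ, c k *
        (Real.exp (-(((k : ℝ) + 1) * ω) ^ 2 * p.1) * Real.sin (((k : ℝ) + 1) * ω * (p.2 - a))))
        (Ioi (t / 2) ×ˢ univ) := by
      refine continuousOn_tsum (fun k => by fun_prop) (hs 0 (t / 2) (by positivity)) ?_
      rintro k ⟨s, y⟩ ⟨hs', -⟩
      simpa using key 0 (t / 2) s _ (by positivity) (le_of_lt hs') (Real.abs_sin_le_one _) k
    refine (h1.continuousAt ?_).continuousWithinAt
    exact prod_mem_nhds (Ioi_mem_nhds (by linarith)) univ_mem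
  · refine hasDerivAt_tsum (g' := fun k x => c k * ((((k : ℝ) + 1) * ω) ^ 1 *
      Real.exp (-(((k : ℝ) + 1) * ω) ^ 2 * t) * Real.cos (((k : ℝ) + 1) * ω * (x - a))))
      (hs 1 t ht) (fun k y => ?_) (fun k y => key 1 t t _ ht le_rfl
      (Real.abs_cos_le_one _) k) (y₀ := a) ?_ x
    · refine (((hsin k y).const_mul (Real.exp (-(((k : ℝ) + 1) * ω) ^ 2 * t))).const_mul
        (c k)).congr_deriv ?_
      ring
    · simp
  · refine hasDerivAt_tsum (g' := fun k x => c k * ((((k : ℝ) + 1) * ω) ^ 2 *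
      Real.exp (-(((k : ℝ) + 1) * ω) ^ 2 * t) * -Real.sin (((k : ℝ) + 1) * ω * (x - a))))
      (hs 2 t ht) (fun k y => ?_) (fun k y => key 2 t t _ ht le_rfl
      (by rw [abs_neg]; exact Real.abs_sin_le_one _) k) (y₀ := a) ?_ x
    · refine (((hcos k y).const_mul ((((k : ℝ) + 1) * ω) ^ 1 *
        Real.exp (-(((k : ℝ) + 1) * ω) ^ 2 * t))).const_mul (c k)).congr_deriv ?_
      ring
    · exact Summable.of_norm_bounded (hs 1 t ht) fun k => key 1 t t _ ht le_rfl
        (Real.abs_cos_le_one _) k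
  · refine hasDerivAt_tsum_of_isPreconnected (hs 2 (t / 2) (by positivity)) isOpen_Ioi
      isPreconnected_Ioi (t := Ioi (t / 2)) (fun k s _ => ?_) (fun k s hs' => key 2 (t / 2) s _
        (by positivity) (le_of_lt hs') (by rw [abs_neg]; exact Real.abs_sin_le_one _) k)
      (y₀ := t) (half_lt_self ht) ?_ (half_lt_self ht)
    · have h1 := ((hasDerivAt_id s).const_mul (-(((k : ℝ) + 1) * ω) ^ 2)).exp
      refine ((h1.mul_const (Real.sin (((k : ℝ) + 1) * ω * (x - a)))).const_mul
        (c k)).congr_deriv ?_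
      simp only [id]
      ring
    · refine Summable.of_norm_bounded (hs 0 t ht) fun k => ?_
      simpa using key 0 t t _ ht le_rfl (Real.abs_sin_le_one (((k : ℝ) + 1) * ω * (x - a))) k

theorem abs_dirichletEigenfunction_le (a b : ℝ) (k : ℕ) (y : ℝ) :
    |dirichletEigenfunction a b k y| ≤ Real.sqrt (2 / (b - a)) := by
  rw [dirichletEigenfunction, abs_mul, abs_of_nonneg (Real.sqrt_nonneg _)]
  exact mul_le_of_le_one_right (Real.sqrt_nonneg _) (Real.abs_sin_le_one _)

theorem abs_integral_mul_dirichletEigenfunction_le {a b : ℝ} {φ : ℝ → ℝ}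
    (hφ : IntegrableOn φ (Ioo a b)) (k : ℕ) :
    |∫ y in Ioo a b, φ y * dirichletEigenfunction a b k y| ≤
      ∫ y in Ioo a b, |φ y| * Real.sqrt (2 / (b - a)) := by
  rw [← Real.norm_eq_abs]
  refine norm_integral_le_of_norm_le (hφ.abs.mul_const _) (Eventually.of_forall fun y => ?_)
  rw [Real.norm_eq_abs, abs_mul]
  exact mul_le_mul_of_nonneg_left (abs_dirichletEigenfunction_le a b k y) (abs_nonneg _)

theorem isHeatSolution_dirichletHeat {a b : ℝ} (hab : a < b) {φ : ℝ → ℝ}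
    (hφ : IntegrableOn φ (Ioo a b)) : IsHeatSolution fun t x => dirichletHeat a b t φ x := by
  have hL : 0 < b - a := sub_pos.2 hab
  have h := isHeatSolution_sine_series (a := a) (ω := Real.pi / (b - a))
    (c := fun k => (∫ y in Ioo a b, φ y * dirichletEigenfunction a b k y) *
      Real.sqrt (2 / (b - a)))
    (M := (∫ y in Ioo a b, |φ y| * Real.sqrt (2 / (b - a))) * Real.sqrt (2 / (b - a)))
    (by positivity) fun k => by
      rw [abs_mul, abs_of_nonneg (Real.sqrt_nonneg _)]
      exact mul_le_mul_of_nonneg_right (abs_integral_mul_dirichletEigenfunction_le hφ k)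
        (Real.sqrt_nonneg _)
  refine (iff_of_eq (congrArg IsHeatSolution ?_)).mpr h
  funext t x
  refine tsum_congr fun k => ?_
  rw [dirichletEigenvalue, dirichletEigenfunction]
  have h1 : ((k : ℝ) + 1) * Real.pi * (x - a) / (b - a) =
      ((k : ℝ) + 1) * (Real.pi / (b - a)) * (x - a) := by ring
  have h2 : ((k : ℝ) + 1) * Real.pi / (b - a) = ((k : ℝ) + 1) * (Real.pi / (b - a)) := by ring
  rw [h1, h2]
  ring

theorem dirichletHeat_left {a b : ℝ} (hab : a < b) (t : ℝ) (φ : ℝ → ℝ) :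
    dirichletHeat a b t φ a = 0 := by
  simp [dirichletHeat, (dirichletEigenfunction_boundary hab _).1]

theorem dirichletHeat_right {a b : ℝ} (hab : a < b) (t : ℝ) (φ : ℝ → ℝ) :
    dirichletHeat a b t φ b = 0 := by
  simp [dirichletHeat, (dirichletEigenfunction_boundary hab _).2]

/-! ### The Jacobi triple product and the monotonicity of the alternating theta series. -/

/-- The reciprocal `1 / ∏_{i = 1}^{n} (1 - p ^ i)` of the finite `q`-Pochhammer symbol, extended by
zero to negative `n`. -/
noncomputable def recipPochhammer (p : ℝ) (n : ℤ) : ℝ :=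
  if n < 0 then 0 else (∏ i ∈ Finset.range n.toNat, (1 - p ^ (i + 1)))⁻¹

theorem recipPochhammer_natCast (p : ℝ) (n : ℕ) :
    recipPochhammer p n = (∏ i ∈ Finset.range n, (1 - p ^ (i + 1)))⁻¹ := by
  simp [recipPochhammer]

theorem recipPochhammer_of_neg (p : ℝ) {n : ℤ} (hn : n < 0) : recipPochhammer p n = 0 := by
  simp [recipPochhammer, hn]

theorem one_sub_pow_succ_pos {p : ℝ} (hp0 : 0 ≤ p) (hp1 : p < 1) (i : ℕ) :
    0 < 1 - p ^ (i + 1) := sub_pos.2 (pow_lt_one₀ hp0 hp1 i.succ_ne_zero)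

/-- Extension by zero is consistent with the recursion at `n = 0`, where the factor `1 - p ^ 0`
vanishes. -/
theorem recipPochhammer_sub_one {p : ℝ} (hp0 : 0 ≤ p) (hp1 : p < 1) (n : ℤ) :
    recipPochhammer p (n - 1) = (1 - p ^ n) * recipPochhammer p n := by
  rcases lt_or_ge n 0 with hn | hn
  · rw [recipPochhammer_of_neg p hn, recipPochhammer_of_neg p (by lia), mul_zero]
  lift n to ℕ using hn
  rcases n with _ | n
  · simp [recipPochhammer]
  · have h1 : ((n + 1 : ℕ) : ℤ) - 1 = n := by push_cast; ring
    rw [h1, recipPochhammer_natCast, recipPochhammer_natCast, Finset.prod_range_succ, mul_inv,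
      zpow_natCast]
    have := (one_sub_pow_succ_pos hp0 hp1 n).ne'
    field_simp

theorem recipPochhammer_nonneg {p : ℝ} (hp0 : 0 ≤ p) (hp1 : p < 1) (n : ℤ) :
    0 ≤ recipPochhammer p n := by
  rw [recipPochhammer]
  split_ifs
  · rfl
  · exact inv_nonneg.2 (Finset.prod_nonneg fun i _ => (one_sub_pow_succ_pos hp0 hp1 i).le)

theorem recipPochhammer_natCast_monotone {p : ℝ} (hp0 : 0 ≤ p) (hp1 : p < 1) :
    Monotone fun n : ℕ => recipPochhammer p n := by
  refine monotone_nat_of_le_succ fun n => ?_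
  have h := recipPochhammer_sub_one hp0 hp1 ((n + 1 : ℕ) : ℤ)
  have h1 : ((n + 1 : ℕ) : ℤ) - 1 = n := by push_cast; ring
  rw [h1] at h
  rw [h, zpow_natCast]
  exact mul_le_of_le_one_left (recipPochhammer_nonneg hp0 hp1 _)
    (sub_le_self _ (pow_nonneg hp0 _))

/-- The sequence increases, and each factor `1 / (1 - p ^ (i + 1))` is at most `exp (p ^ (i + 1) /
(1 - p))`, so a geometric series bounds the products. -/
theorem exists_tendsto_recipPochhammer {p : ℝ} (hp0 : 0 ≤ p) (hp1 : p < 1) :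
    ∃ C, 1 ≤ C ∧ Tendsto (fun n : ℕ => recipPochhammer p n) atTop (𝓝 C) ∧
      ∀ n : ℤ, recipPochhammer p n ≤ C := by
  have hb : ∀ n : ℕ, recipPochhammer p n ≤
      Real.exp (∑ i ∈ Finset.range n, p ^ (i + 1) / (1 - p)) := fun n => by
    rw [recipPochhammer_natCast, ← Finset.prod_inv_distrib, Real.exp_sum]
    refine Finset.prod_le_prod
      (fun i _ => inv_nonneg.2 (one_sub_pow_succ_pos hp0 hp1 i).le) fun i _ => ?_
    refine le_trans ?_ (Real.add_one_le_exp _)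
    have h1 := one_sub_pow_succ_pos hp0 hp1 i
    have h2 : p ^ (i + 1) ≤ p := pow_le_of_le_one hp0 hp1.le i.succ_ne_zero
    have h3 : (0 : ℝ) < 1 - p := by linarith
    have h4 : (1 - p ^ (i + 1))⁻¹ = p ^ (i + 1) / (1 - p ^ (i + 1)) + 1 := by
      field_simp
      ring
    rw [h4]
    gcongr
  have hs : Summable fun i : ℕ => p ^ (i + 1) / (1 - p) :=
    ((summable_nat_add_iff 1).2 (summable_geometric_of_lt_one hp0 hp1)).div_const _
  have hb' : BddAbove (range fun n : ℕ => recipPochhammer p n) := by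
    refine ⟨Real.exp (∑' i : ℕ, p ^ (i + 1) / (1 - p)), ?_⟩
    rintro _ ⟨n, rfl⟩
    refine (hb n).trans (Real.exp_le_exp.2 (hs.sum_le_tsum _ fun i _ => ?_))
    exact div_nonneg (pow_nonneg hp0 _) (by linarith)
  have h1 : recipPochhammer p (0 : ℕ) = 1 := by simp [recipPochhammer]
  refine ⟨_, ?_, tendsto_atTop_ciSup (recipPochhammer_natCast_monotone hp0 hp1) hb', fun n => ?_⟩
  · rw [← h1]
    exact le_ciSup hb' 0
  · rcases lt_or_ge n 0 with hn | hn
    · rw [recipPochhammer_of_neg p hn]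
      refine le_trans zero_le_one ?_
      rw [← h1]
      exact le_ciSup hb' 0
    · lift n to ℕ using hn
      exact le_ciSup hb' n

/-- The terms of the finite Jacobi triple product. -/
noncomputable def tripleTerm (q s : ℝ) (N : ℕ) (j : ℤ) : ℝ :=
  (-1) ^ j * q ^ (j ^ 2) * (recipPochhammer (q ^ 2) (N + j) * recipPochhammer (q ^ 2) (N - j)) *
    Real.exp (j * s)

theorem summable_tripleTerm (q s : ℝ) (N : ℕ) : Summable (tripleTerm q s N) := by
  refine summable_of_ne_finset_zero (s := Finset.Icc (-N : ℤ) N) fun j hj => ?_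
  rw [Finset.mem_Icc, not_and_or] at hj
  rcases hj with hj | hj
  · simp [tripleTerm, recipPochhammer_of_neg (q ^ 2) (show (N : ℤ) + j < 0 by lia)]
  · simp [tripleTerm, recipPochhammer_of_neg (q ^ 2) (show (N : ℤ) - j < 0 by lia)]

/-- This is the induction step of the finite triple product, read off at the frequency `e^{js}`: the
new factor is `1 + q^{4N+2} - q^{2N+1}(e^s + e^{-s})`, and multiplication by `e^{±s}` shifts `j`. -/
theorem tripleTerm_recurrence {q : ℝ} (hq0 : 0 < q) (hq1 : q < 1) (s : ℝ) (N : ℕ) (j : ℤ) :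
    (1 + q ^ (4 * N + 2)) * tripleTerm q s N j -
        q ^ (2 * N + 1) * (Real.exp s * tripleTerm q s N (j - 1) +
          Real.exp (-s) * tripleTerm q s N (j + 1)) =
      (1 - (q ^ 2) ^ (2 * N + 1)) * (1 - (q ^ 2) ^ (2 * N + 2)) * tripleTerm q s (N + 1) j := by
  have hp0 : 0 ≤ q ^ 2 := by positivity
  have hp1 : q ^ 2 < 1 := by nlinarith
  have hq : q ≠ 0 := hq0.ne'
  have hm : (-1 : ℝ) ≠ 0 := by norm_num
  have e1 : Real.exp s * Real.exp (((j - 1 : ℤ) : ℝ) * s) = Real.exp (j * s) := by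
    rw [← Real.exp_add]; push_cast; ring_nf
  have e2 : Real.exp (-s) * Real.exp (((j + 1 : ℤ) : ℝ) * s) = Real.exp (j * s) := by
    rw [← Real.exp_add]; push_cast; ring_nf
  have s1 : (-1 : ℝ) ^ (j - 1) = -(-1) ^ j := by rw [zpow_sub_one₀ hm]; norm_num
  have s2 : (-1 : ℝ) ^ (j + 1) = -(-1) ^ j := by rw [zpow_add₀ hm]; simp
  have r1 := recipPochhammer_sub_one hp0 hp1 (N + j)
  have r2 := recipPochhammer_sub_one hp0 hp1 (N + j + 1)
  have r3 := recipPochhammer_sub_one hp0 hp1 (N - j)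
  have r4 := recipPochhammer_sub_one hp0 hp1 (N - j + 1)
  rw [add_sub_cancel_right] at r2 r4
  have i1 : (N : ℤ) + (j - 1) = N + j - 1 := by ring
  have i2 : (N : ℤ) - (j - 1) = N - j + 1 := by ring
  have i3 : (N : ℤ) + (j + 1) = N + j + 1 := by ring
  have i4 : (N : ℤ) - (j + 1) = N - j - 1 := by ring
  have i5 : ((N + 1 : ℕ) : ℤ) + j = N + j + 1 := by push_cast; ring
  have i6 : ((N + 1 : ℕ) : ℤ) - j = N - j + 1 := by push_cast; ring
  have p1 : (q ^ 2) ^ ((N : ℤ) + j + 1) = q ^ 2 * (q ^ 2) ^ ((N : ℤ) + j) := by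
    rw [zpow_add_one₀ (by positivity), mul_comm]
  have p2 : (q ^ 2) ^ ((N : ℤ) - j + 1) = q ^ 2 * (q ^ 2) ^ ((N : ℤ) - j) := by
    rw [zpow_add_one₀ (by positivity), mul_comm]
  have p3 : (q ^ 2) ^ (2 * N + 1) = q ^ 2 * ((q ^ 2) ^ ((N : ℤ) + j) * (q ^ 2) ^ ((N : ℤ) - j)) := by
    rw [← zpow_add₀ (by positivity), show (N : ℤ) + j + (N - j) = ((2 * N : ℕ) : ℤ) by push_cast; ring,
      zpow_natCast]
    ring
  have p4 : (q ^ 2) ^ (2 * N + 2) = (q ^ 2) ^ 2 * ((q ^ 2) ^ ((N : ℤ) + j) * (q ^ 2) ^ ((N : ℤ) - j)) := by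
    rw [← zpow_add₀ (by positivity), show (N : ℤ) + j + (N - j) = ((2 * N : ℕ) : ℤ) by push_cast; ring,
      zpow_natCast]
    ring
  have p5 : q ^ (4 * N + 2) = (q ^ 2) ^ (2 * N + 1) := by ring
  have p6 : q ^ (2 * N + 1) * q ^ ((j - 1) ^ 2) = q ^ (j ^ 2) * (q ^ 2 * (q ^ 2) ^ ((N : ℤ) - j)) := by
    have : (q ^ 2) ^ ((N : ℤ) - j) = q ^ (2 * ((N : ℤ) - j)) := by
      rw [zpow_mul]; rfl
    rw [this, ← zpow_natCast q 2, ← zpow_natCast, ← zpow_add₀ hq, ← zpow_add₀ hq, ← zpow_add₀ hq]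
    congr 1; push_cast; ring
  have p7 : q ^ (2 * N + 1) * q ^ ((j + 1) ^ 2) = q ^ (j ^ 2) * (q ^ 2 * (q ^ 2) ^ ((N : ℤ) + j)) := by
    have : (q ^ 2) ^ ((N : ℤ) + j) = q ^ (2 * ((N : ℤ) + j)) := by
      rw [zpow_mul]; rfl
    rw [this, ← zpow_natCast q 2, ← zpow_natCast, ← zpow_add₀ hq, ← zpow_add₀ hq, ← zpow_add₀ hq]
    congr 1; push_cast; ring
  rw [p1] at r2
  rw [p2] at r4
  simp only [tripleTerm, i1, i2, i3, i4, i5, i6, s1, s2, r1, r3, p5, p4, p3]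
  -- All powers of `q` have been expressed through `q ^ (j ^ 2)`, `q ^ 2`, `X` and `Y`, and all
  -- Pochhammer symbols through `A` and `B`, those of highest index. What remains is a polynomial
  -- identity.
  set X := (q ^ 2) ^ ((N : ℤ) + j)
  set Y := (q ^ 2) ^ ((N : ℤ) - j)
  set A := recipPochhammer (q ^ 2) (N + j + 1)
  set B := recipPochhammer (q ^ 2) (N - j + 1)
  rw [r2, r4]
  clear_value X Y A B
  set E := Real.exp (j * s)
  have t1 : q ^ (2 * N + 1) * (Real.exp s * (-(-1) ^ j * q ^ ((j - 1) ^ 2) *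
      ((1 - X) * ((1 - q ^ 2 * X) * A) * B) * Real.exp (((j - 1 : ℤ) : ℝ) * s))) =
      -((-1) ^ j * (q ^ (j ^ 2) * (q ^ 2 * Y)) * ((1 - X) * ((1 - q ^ 2 * X) * A) * B) * E) := by
    rw [← p6, ← e1]; ring
  have t2 : q ^ (2 * N + 1) * (Real.exp (-s) * (-(-1) ^ j * q ^ ((j + 1) ^ 2) *
      (A * ((1 - Y) * ((1 - q ^ 2 * Y) * B))) * Real.exp (((j + 1 : ℤ) : ℝ) * s))) =
      -((-1) ^ j * (q ^ (j ^ 2) * (q ^ 2 * X)) * (A * ((1 - Y) * ((1 - q ^ 2 * Y) * B))) * E) := by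
    rw [← p7, ← e2]; ring
  rw [mul_add, t1, t2]
  ring

/-- The finite form of the Jacobi triple product. -/
theorem finite_triple_product {q : ℝ} (hq0 : 0 < q) (hq1 : q < 1) (s : ℝ) (N : ℕ) :
    ∏ m ∈ Finset.range N, (1 - 2 * q ^ (2 * m + 1) * Real.cosh s + q ^ (4 * m + 2)) =
      (∏ i ∈ Finset.range (2 * N), (1 - (q ^ 2) ^ (i + 1))) * ∑' j : ℤ, tripleTerm q s N j := by
  induction N with
  | zero =>
    rw [tsum_eq_single 0]
    · simp [tripleTerm, recipPochhammer]
    · intro j hj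
      rcases lt_or_gt_of_ne hj with h | h
      · simp [tripleTerm, recipPochhammer_of_neg (q ^ 2) h]
      · simp [tripleTerm, recipPochhammer_of_neg (q ^ 2) (show -j < 0 by lia)]
  | succ N ih =>
    have hS := summable_tripleTerm q s N
    have h1 : HasSum (fun j : ℤ => tripleTerm q s N (j - 1)) (∑' j : ℤ, tripleTerm q s N j) :=
      ((Equiv.subRight (1 : ℤ)).hasSum_iff (f := tripleTerm q s N)).2 hS.hasSum
    have h2 : HasSum (fun j : ℤ => tripleTerm q s N (j + 1)) (∑' j : ℤ, tripleTerm q s N j) :=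
      ((Equiv.addRight (1 : ℤ)).hasSum_iff (f := tripleTerm q s N)).2 hS.hasSum
    have h3 := (hS.hasSum.mul_left (1 + q ^ (4 * N + 2))).sub
      (((h1.mul_left (Real.exp s)).add (h2.mul_left (Real.exp (-s)))).mul_left (q ^ (2 * N + 1)))
    simp only [tripleTerm_recurrence hq0 hq1] at h3
    have h4 := h3.unique ((summable_tripleTerm q s (N + 1)).hasSum.mul_left _)
    rw [Finset.prod_range_succ, ih, show 2 * (N + 1) = 2 * N + 1 + 1 by ring,
      Finset.prod_range_succ, Finset.prod_range_succ, Real.cosh_eq]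
    linear_combination (∏ i ∈ Finset.range (2 * N), (1 - (q ^ 2) ^ (i + 1))) * h4

/-- Completing the square in `j² log q + j s` gives a theta series with shift `s / (2 log q)`. -/
theorem summable_theta_majorant {q : ℝ} (hq0 : 0 < q) (hq1 : q < 1) (s : ℝ) :
    Summable fun j : ℤ => q ^ (j ^ 2) * Real.exp (j * s) := by
  have hl : 0 < -Real.log q := neg_pos.2 (Real.log_neg hq0 hq1)
  have h := (HurwitzZeta.hasSum_int_evenKernel (s / (2 * Real.log q))
    (t := -Real.log q / Real.pi) (by positivity)).summable.mul_left
      (Real.exp (-(s ^ 2 / (4 * Real.log q))))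
  refine h.congr fun j => ?_
  rw [← Real.rpow_intCast q, Real.rpow_def_of_pos hq0, ← Real.exp_add, ← Real.exp_add]
  congr 1
  have hl' : Real.log q ≠ 0 := by linarith [hl]
  have := Real.pi_ne_zero
  push_cast
  field_simp
  ring

/-- The alternating theta series in its multiplicative normalisation. -/
noncomputable def altTheta (q s : ℝ) : ℝ := ∑' j : ℤ, (-1) ^ j * q ^ (j ^ 2) * Real.exp (j * s)

/-- Dominated convergence applies to the sum. The constant is positive and independent of `s`, so
signs and monotonicity in `s` pass to the limit without its value being known. -/
theorem tendsto_tripleTerm_sum {q : ℝ} (hq0 : 0 < q) (hq1 : q < 1) :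
    ∃ C, 0 < C ∧ ∀ s, Tendsto (fun N : ℕ => ∑' j : ℤ, tripleTerm q s N j) atTop
      (𝓝 (C * altTheta q s)) := by
  have hp0 : 0 ≤ q ^ 2 := by positivity
  have hp1 : q ^ 2 < 1 := by nlinarith
  obtain ⟨C, hC, hlim, hle⟩ := exists_tendsto_recipPochhammer hp0 hp1
  refine ⟨C * C, by positivity, fun s => ?_⟩
  rw [altTheta, ← tsum_mul_left]
  refine tendsto_tsum_of_dominated_convergence
    ((summable_theta_majorant hq0 hq1 s).mul_left (C * C)) (fun j => ?_) ?_
  · have h1 : Tendsto (fun N : ℕ => recipPochhammer (q ^ 2) ((N : ℤ) + j)) atTop (𝓝 C) := by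
      have : Tendsto (fun N : ℕ => ((N : ℤ) + j).toNat) atTop atTop :=
        tendsto_atTop.2 fun n => by
          filter_upwards [eventually_ge_atTop (n + j.natAbs)] with N hN
          lia
      refine (hlim.comp this).congr' ?_
      filter_upwards [eventually_ge_atTop j.natAbs] with N hN
      simp only [Function.comp]
      congr 1
      lia
    have h2 : Tendsto (fun N : ℕ => recipPochhammer (q ^ 2) ((N : ℤ) - j)) atTop (𝓝 C) := by
      have : Tendsto (fun N : ℕ => ((N : ℤ) - j).toNat) atTop atTop :=
        tendsto_atTop.2 fun n => by
          filter_upwards [eventually_ge_atTop (n + j.natAbs)] with N hN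
          lia
      refine (hlim.comp this).congr' ?_
      filter_upwards [eventually_ge_atTop j.natAbs] with N hN
      simp only [Function.comp]
      congr 1
      lia
    have h3 := ((h1.mul h2).const_mul ((-1) ^ j * q ^ (j ^ 2))).mul_const (Real.exp (j * s))
    refine h3.trans_eq ?_
    ring_nf
  · refine Eventually.of_forall fun N j => ?_
    have hA := recipPochhammer_nonneg hp0 hp1 (N + j)
    have hB := recipPochhammer_nonneg hp0 hp1 (N - j)
    rw [tripleTerm, norm_mul, norm_mul, norm_mul, norm_mul, norm_zpow, norm_neg, norm_one,
      one_zpow, one_mul, Real.norm_of_nonneg (by positivity : 0 ≤ q ^ (j ^ 2)),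
      Real.norm_of_nonneg hA, Real.norm_of_nonneg hB, Real.norm_of_nonneg (Real.exp_pos _).le]
    have : recipPochhammer (q ^ 2) (N + j) * recipPochhammer (q ^ 2) (N - j) ≤ C * C :=
      mul_le_mul (hle _) (hle _) hB (by linarith)
    calc _ = recipPochhammer (q ^ 2) (N + j) * recipPochhammer (q ^ 2) (N - j) *
          (q ^ (j ^ 2) * Real.exp (j * s)) := by ring
      _ ≤ _ := mul_le_mul_of_nonneg_right this (by positivity)

/-- The factor splits as `(1 - q^{2m+1} e^s)(1 - q^{2m+1} e^{-s})`, and `q e^s ≤ 1` makes both parts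
nonnegative. -/
theorem tripleFactor_nonneg {q s : ℝ} (hq0 : 0 < q) (hq1 : q < 1) (hs : 0 ≤ s)
    (hqs : q * Real.exp s ≤ 1) (m : ℕ) :
    0 ≤ 1 - 2 * q ^ (2 * m + 1) * Real.cosh s + q ^ (4 * m + 2) := by
  have hr0 : 0 < q ^ (2 * m + 1) := by positivity
  have hrq : q ^ (2 * m + 1) ≤ q := pow_le_of_le_one hq0.le hq1.le (by simp)
  have h1 : q ^ (2 * m + 1) * Real.exp s ≤ 1 :=
    (mul_le_mul_of_nonneg_right hrq (Real.exp_pos s).le).trans hqs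
  have h2 : q ^ (2 * m + 1) * Real.exp (-s) ≤ 1 :=
    (mul_le_mul_of_nonneg_left (Real.exp_le_exp.2 (by linarith)) hr0.le).trans h1
  have h3 : 1 - 2 * q ^ (2 * m + 1) * Real.cosh s + q ^ (4 * m + 2) =
      (1 - q ^ (2 * m + 1) * Real.exp s) * (1 - q ^ (2 * m + 1) * Real.exp (-s)) := by
    have h4 : q ^ (4 * m + 2) = q ^ (2 * m + 1) * q ^ (2 * m + 1) := by ring
    rw [Real.cosh_eq, h4]
    have h5 : Real.exp s * Real.exp (-s) = 1 := by rw [← Real.exp_add]; simp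
    linear_combination (-(q ^ (2 * m + 1) * q ^ (2 * m + 1))) * h5
  rw [h3]
  exact mul_nonneg (by linarith) (by linarith)

theorem tsum_tripleTerm_nonneg {q s : ℝ} (hq0 : 0 < q) (hq1 : q < 1) (hs : 0 ≤ s)
    (hqs : q * Real.exp s ≤ 1) (N : ℕ) : 0 ≤ ∑' j : ℤ, tripleTerm q s N j := by
  have hpos : 0 < ∏ i ∈ Finset.range (2 * N), (1 - (q ^ 2) ^ (i + 1)) :=
    Finset.prod_pos fun i _ => one_sub_pow_succ_pos (by positivity) (by nlinarith) i
  refine nonneg_of_mul_nonneg_right ?_ hpos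
  rw [← finite_triple_product hq0 hq1]
  exact Finset.prod_nonneg fun m _ => tripleFactor_nonneg hq0 hq1 hs hqs m

theorem altTheta_nonneg {q s : ℝ} (hq0 : 0 < q) (hq1 : q < 1) (hs : 0 ≤ s)
    (hqs : q * Real.exp s ≤ 1) : 0 ≤ altTheta q s := by
  obtain ⟨C, hC, h⟩ := tendsto_tripleTerm_sum hq0 hq1
  exact nonneg_of_mul_nonneg_right
    (ge_of_tendsto' (h s) (tsum_tripleTerm_nonneg hq0 hq1 hs hqs)) hC

/-- In product form, every factor is nonnegative and decreases as `cosh s` grows; the alternating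
series itself does not reveal this. -/
theorem altTheta_antitone {q s s' : ℝ} (hq0 : 0 < q) (hq1 : q < 1) (hs : 0 ≤ s) (hss : s ≤ s')
    (hqs : q * Real.exp s' ≤ 1) : altTheta q s' ≤ altTheta q s := by
  obtain ⟨C, hC, h⟩ := tendsto_tripleTerm_sum hq0 hq1
  refine le_of_mul_le_mul_left (le_of_tendsto_of_tendsto' (h s') (h s) fun N => ?_) hC
  have hpos : 0 < ∏ i ∈ Finset.range (2 * N), (1 - (q ^ 2) ^ (i + 1)) :=
    Finset.prod_pos fun i _ => one_sub_pow_succ_pos (by positivity) (by nlinarith) i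
  refine le_of_mul_le_mul_left ?_ hpos
  rw [← finite_triple_product hq0 hq1, ← finite_triple_product hq0 hq1]
  refine Finset.prod_le_prod
    (fun m _ => tripleFactor_nonneg hq0 hq1 (hs.trans hss) hqs m) fun m _ => ?_
  have hcosh : Real.cosh s ≤ Real.cosh s' :=
    Real.cosh_le_cosh.2 (by rwa [abs_of_nonneg hs, abs_of_nonneg (hs.trans hss)])
  have : 2 * q ^ (2 * m + 1) * Real.cosh s ≤ 2 * q ^ (2 * m + 1) * Real.cosh s' :=
    mul_le_mul_of_nonneg_left hcosh (by positivity)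
  linarith

/-! ### The Dirichlet heat kernel by the method of images. -/

/-- The Gauss kernel. -/
noncomputable def gaussKernel (t z : ℝ) : ℝ :=
  (4 * Real.pi * t) ^ (-(1 / 2) : ℝ) * Real.exp (-z ^ 2 / (4 * t))

theorem lineHeat_eq (t : ℝ) (φ : ℝ → ℝ) (x : ℝ) :
    lineHeat t φ x = ∫ y, gaussKernel t (x - y) * φ y := rfl

theorem gaussKernel_pos {t : ℝ} (ht : 0 < t) (z : ℝ) : 0 < gaussKernel t z := by
  unfold gaussKernel; positivity

theorem gaussKernel_neg (t z : ℝ) : gaussKernel t (-z) = gaussKernel t z := by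
  simp [gaussKernel]

theorem gaussKernel_le {t z w : ℝ} (ht : 0 < t) (h : |z| ≤ |w|) :
    gaussKernel t w ≤ gaussKernel t z := by
  unfold gaussKernel
  have := sq_le_sq.2 h
  gcongr

theorem continuous_gaussKernel (t : ℝ) : Continuous (gaussKernel t) := by
  unfold gaussKernel; fun_prop

/-- Poisson summation, in the form of the functional equation between `evenKernel` and `cosKernel`,
turns the `2L`-periodised Gauss kernel into a cosine series. -/
theorem hasSum_int_gaussKernel {t L : ℝ} (ht : 0 < t) (hL : 0 < L) (z : ℝ) :
    HasSum (fun n : ℤ => gaussKernel t (z + 2 * n * L))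
      (1 / (2 * L) * HurwitzZeta.cosKernel ((z / (2 * L) : ℝ) : UnitAddCircle)
        (Real.pi * t / L ^ 2)) := by
  have hpi := Real.pi_pos
  set τ := L ^ 2 / (Real.pi * t) with hτ
  have hτ0 : 0 < τ := by positivity
  have h := (HurwitzZeta.hasSum_int_evenKernel (z / (2 * L)) hτ0).mul_left
    ((4 * Real.pi * t) ^ (-(1 / 2) : ℝ))
  rw [HurwitzZeta.evenKernel_functional_equation] at h
  have h1 : 1 / τ = Real.pi * t / L ^ 2 := by rw [hτ]; field_simp
  have h2 : (4 * Real.pi * t) ^ (-(1 / 2) : ℝ) * (1 / τ ^ (1 / 2 : ℝ)) = 1 / (2 * L) := by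
    rw [Real.rpow_neg (by positivity), ← one_div, one_div_mul_one_div,
      ← Real.mul_rpow (by positivity) hτ0.le, ← Real.sqrt_eq_rpow]
    have : 4 * Real.pi * t * τ = (2 * L) ^ 2 := by rw [hτ]; field_simp; ring
    rw [this, Real.sqrt_sq (by positivity)]
  rw [h1, ← mul_assoc, h2] at h
  refine h.congr_fun fun n => ?_
  rw [gaussKernel]
  congr 2
  rw [hτ]
  field_simp
  ring

/-- A product of sines is half a difference of cosines, and the constant modes of the two cosine
series cancel. -/
theorem hasSum_spectral {a b t : ℝ} (hab : a < b) (ht : 0 < t) (x y : ℝ) :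
    HasSum (fun k : ℕ => Real.exp (-dirichletEigenvalue a b k * t) *
      dirichletEigenfunction a b k x * dirichletEigenfunction a b k y)
      (1 / (2 * (b - a)) * HurwitzZeta.cosKernel (((x - y) / (2 * (b - a)) : ℝ) : UnitAddCircle)
        (Real.pi * t / (b - a) ^ 2) -
      1 / (2 * (b - a)) * HurwitzZeta.cosKernel
        (((x + y - 2 * a) / (2 * (b - a)) : ℝ) : UnitAddCircle) (Real.pi * t / (b - a) ^ 2)) := by
  have hL : 0 < b - a := sub_pos.2 hab
  have hpi := Real.pi_pos
  have hτ : 0 < Real.pi * t / (b - a) ^ 2 := by positivity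
  have h := ((HurwitzZeta.hasSum_nat_cosKernel₀ ((x - y) / (2 * (b - a))) hτ).sub
    (HurwitzZeta.hasSum_nat_cosKernel₀ ((x + y - 2 * a) / (2 * (b - a))) hτ)).mul_left
      (1 / (2 * (b - a)))
  rw [sub_sub_sub_cancel_right] at h
  rw [← mul_sub]
  refine h.congr_fun fun k => ?_
  set L := b - a
  have e1 : 2 * Real.pi * ((x - y) / (2 * L)) * (k + 1) =
      (k + 1) * Real.pi * (x - a) / L - (k + 1) * Real.pi * (y - a) / L := by field_simp; ring
  have e2 : 2 * Real.pi * ((x + y - 2 * a) / (2 * L)) * (k + 1) =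
      (k + 1) * Real.pi * (x - a) / L + (k + 1) * Real.pi * (y - a) / L := by field_simp; ring
  have e3 : -Real.pi * ((k : ℝ) + 1) ^ 2 * (Real.pi * t / L ^ 2) =
      -((k + 1) * Real.pi / L) ^ 2 * t := by field_simp
  have e4 : Real.sqrt (2 / L) * Real.sqrt (2 / L) = 2 / L := Real.mul_self_sqrt (by positivity)
  rw [e1, e2, e3, Real.cos_sub, Real.cos_add]
  simp only [dirichletEigenvalue, dirichletEigenfunction]
  set S := Real.sqrt (2 / L)
  set E := Real.exp (-((k + 1) * Real.pi / L) ^ 2 * t)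
  set u := Real.sin ((k + 1) * Real.pi * (x - a) / L)
  set v := Real.sin ((k + 1) * Real.pi * (y - a) / L)
  have e5 : E * (S * u) * (S * v) = 2 / L * (E * u * v) := by rw [← e4]; ring
  rw [e5]
  field_simp
  ring

/-- The Dirichlet heat kernel on `(a, b)`, as a sum over reflected images. -/
noncomputable def dirichletKernel (a b t x y : ℝ) : ℝ :=
  ∑' n : ℤ, gaussKernel t (x - y + 2 * n * (b - a)) -
    ∑' n : ℤ, gaussKernel t (x + y - 2 * a + 2 * n * (b - a))

theorem hasSum_dirichletKernel {a b t : ℝ} (hab : a < b) (ht : 0 < t) (x y : ℝ) :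
    HasSum (fun k : ℕ => Real.exp (-dirichletEigenvalue a b k * t) *
      dirichletEigenfunction a b k x * dirichletEigenfunction a b k y)
      (dirichletKernel a b t x y) := by
  rw [dirichletKernel, (hasSum_int_gaussKernel ht (sub_pos.2 hab) (x - y)).tsum_eq,
    (hasSum_int_gaussKernel ht (sub_pos.2 hab) (x + y - 2 * a)).tsum_eq]
  exact hasSum_spectral hab ht x y

/-- For fixed `x`, the spectral side is a sine series in `y` with bounded coefficients. -/
theorem continuous_dirichletKernel {a b t : ℝ} (hab : a < b) (ht : 0 < t) (x : ℝ) :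
    Continuous (dirichletKernel a b t x) := by
  have hL : 0 < b - a := sub_pos.2 hab
  obtain ⟨-, Wx, Wxx, h⟩ := isHeatSolution_sine_series (a := a) (ω := Real.pi / (b - a))
    (c := fun k => dirichletEigenfunction a b k x * Real.sqrt (2 / (b - a)))
    (M := Real.sqrt (2 / (b - a)) * Real.sqrt (2 / (b - a))) (by positivity) fun k => by
      rw [abs_mul, abs_of_nonneg (Real.sqrt_nonneg _)]
      exact mul_le_mul_of_nonneg_right (abs_dirichletEigenfunction_le a b k x) (Real.sqrt_nonneg _)
  have h1 := continuous_iff_continuousAt.2 fun y => (h t ht y).1.continuousAt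
  refine h1.congr fun y => ?_
  rw [← (hasSum_dirichletKernel hab ht x y).tsum_eq]
  refine tsum_congr fun k => ?_
  simp only [dirichletEigenvalue]
  rw [dirichletEigenfunction.eq_1 a b k y]
  have h1 : ((k : ℝ) + 1) * Real.pi * (y - a) / (b - a) =
      ((k : ℝ) + 1) * (Real.pi / (b - a)) * (y - a) := by ring
  have h2 : ((k : ℝ) + 1) * Real.pi / (b - a) = ((k : ℝ) + 1) * (Real.pi / (b - a)) := by ring
  rw [h1, h2]
  ring

theorem dirichletHeat_eq_integral {a b t : ℝ} (hab : a < b) (ht : 0 < t) {φ : ℝ → ℝ}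
    (hφ : IntegrableOn φ (Ioo a b)) (x : ℝ) :
    dirichletHeat a b t φ x = ∫ y in Ioo a b, dirichletKernel a b t x y * φ y := by
  have hL : 0 < b - a := sub_pos.2 hab
  set s := Real.sqrt (2 / (b - a))
  set E : ℕ → ℝ := fun k => Real.exp (-dirichletEigenvalue a b k * t)
  have hcont : ∀ k, Continuous (dirichletEigenfunction a b k) := fun k => by
    unfold dirichletEigenfunction; fun_prop
  have hint : ∀ k, Integrable (fun y => dirichletEigenfunction a b k y * φ y)
      (volume.restrict (Ioo a b)) := fun k =>
    Integrable.bdd_mul hφ (hcont k).aestronglyMeasurable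
      (Eventually.of_forall fun y => abs_dirichletEigenfunction_le a b k y)
  have hF : ∀ k, Integrable (fun y => E k * dirichletEigenfunction a b k x *
      (dirichletEigenfunction a b k y * φ y)) (volume.restrict (Ioo a b)) :=
    fun k => (hint k).const_mul _
  have hE : Summable E := by
    have := summable_pow_mul_exp_neg_sq 0 (ω := Real.pi / (b - a)) (by positivity) ht
    refine this.congr fun k => ?_
    simp only [pow_zero, one_mul, E, dirichletEigenvalue]
    congr 3
    ring
  have hsum : Summable fun k => ∫ y in Ioo a b, ‖E k * dirichletEigenfunction a b k x *
      (dirichletEigenfunction a b k y * φ y)‖ := by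
    refine Summable.of_nonneg_of_le (fun k => integral_nonneg fun y => norm_nonneg _)
      (fun k => ?_) (hE.mul_right (∫ y in Ioo a b, s * (s * |φ y|)))
    rw [← integral_const_mul]
    refine integral_mono (hF k).norm (((hφ.abs.const_mul s).const_mul s).const_mul _) fun y => ?_
    simp only [norm_mul, Real.norm_eq_abs]
    rw [abs_of_pos (Real.exp_pos _), mul_assoc]
    have h1 := abs_dirichletEigenfunction_le a b k x
    have h2 := abs_dirichletEigenfunction_le a b k y
    gcongr
  have h := hasSum_integral_of_summable_integral_norm hF hsum
  have h1 : ∀ y, ∑' k, E k * dirichletEigenfunction a b k x *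
      (dirichletEigenfunction a b k y * φ y) = dirichletKernel a b t x y * φ y := fun y => by
    rw [← ((hasSum_dirichletKernel hab ht x y).mul_right (φ y)).tsum_eq]
    exact tsum_congr fun k => by ring
  simp only [h1] at h
  rw [← h.tsum_eq, dirichletHeat]
  refine tsum_congr fun k => ?_
  rw [integral_const_mul]
  simp only [mul_comm (dirichletEigenfunction a b k _) (φ _)]
  ring

/-- `A`, `A'` collect the positive images on the two sides and `B`, `B'` the negative ones. For `x`,
`y` in `[a, b]` the distances interlace as `B 0 ≤ A 0 ≤ B 1 ≤ A 1 ≤ …`, and likewise for the primed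
ones. Pairing `A n` with `B n` gives the upper kernel bound; pairing it with `B (n + 1)` gives the
lower one. -/
theorem dirichletKernel_split {a b t : ℝ} (hab : a < b) (ht : 0 < t) (x y : ℝ) :
    ∃ A A' B B' : ℕ → ℝ, Summable A ∧ Summable A' ∧ Summable B ∧ Summable B' ∧
      (∀ n, A n = gaussKernel t (x - y + 2 * (n + 1) * (b - a))) ∧
      (∀ n, A' n = gaussKernel t (x - y - 2 * (n + 1) * (b - a))) ∧
      (∀ n, B n = gaussKernel t (x + y - 2 * a + 2 * n * (b - a))) ∧
      (∀ n, B' n = gaussKernel t (x + y - 2 * b - 2 * n * (b - a))) ∧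
      dirichletKernel a b t x y =
        gaussKernel t (x - y) + ∑' n, A n + ∑' n, A' n - ∑' n, B n - ∑' n, B' n := by
  have hA := (hasSum_int_gaussKernel ht (sub_pos.2 hab) (x - y)).summable
  have hB := (hasSum_int_gaussKernel ht (sub_pos.2 hab) (x + y - 2 * a)).summable
  have i1 : Function.Injective fun n : ℕ => (n : ℤ) := Nat.cast_injective
  have i2 : Function.Injective fun n : ℕ => -((n : ℤ) + 1) := fun m n h => by
    simp only at h
    lia
  have hA1 := hA.comp_injective i1
  have hA2 := hA.comp_injective i2
  have hB1 := hB.comp_injective i1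
  have hB2 := hB.comp_injective i2
  have hA3 := (summable_nat_add_iff 1).2 hA1
  refine ⟨_, _, _, _, hA3, hA2, hB1, hB2, fun n => ?_, fun n => ?_,
    fun n => ?_, fun n => ?_, ?_⟩
  · simp
  · simp only [Function.comp]; congr 1; push_cast; ring
  · simp
  · simp only [Function.comp]; congr 1; push_cast; ring
  · rw [dirichletKernel,
      tsum_of_nat_of_neg_add_one (f := fun n : ℤ => gaussKernel t (x - y + 2 * n * (b - a))) hA1 hA2,
      tsum_of_nat_of_neg_add_one
        (f := fun n : ℤ => gaussKernel t (x + y - 2 * a + 2 * n * (b - a))) hB1 hB2]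
    have h := hA1.tsum_eq_zero_add
    simp only [Function.comp] at h ⊢
    rw [h]
    simp only [Nat.cast_zero, Int.cast_zero, mul_zero, zero_mul, add_zero]
    ring

theorem dirichletKernel_le {a b t x y : ℝ} (hab : a < b) (ht : 0 < t) (hx : x ∈ Icc a b)
    (hy : y ∈ Icc a b) : dirichletKernel a b t x y ≤ gaussKernel t (x - y) := by
  obtain ⟨A, A', B, B', hA, hA', hB, hB', eA, eA', eB, eB', h⟩ := dirichletKernel_split hab ht x y
  obtain ⟨hx1, hx2⟩ := hx
  obtain ⟨hy1, hy2⟩ := hy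
  have h1 : ∑' n, A n ≤ ∑' n, B n := hA.tsum_le_tsum (fun n => by
    rw [eA, eB]
    refine gaussKernel_le ht ?_
    have : 0 ≤ 2 * (n : ℝ) * (b - a) := by have := sub_pos.2 hab; positivity
    rw [abs_of_nonneg (by linarith), abs_of_nonneg (by linarith)]
    linarith) hB
  have h2 : ∑' n, A' n ≤ ∑' n, B' n := hA'.tsum_le_tsum (fun n => by
    rw [eA', eB']
    refine gaussKernel_le ht ?_
    have : 0 ≤ 2 * (n : ℝ) * (b - a) := by have := sub_pos.2 hab; positivity
    rw [abs_of_nonpos (by linarith), abs_of_nonpos (by linarith)]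
    linarith) hB'
  rw [h]
  linarith

theorem le_dirichletKernel {a b t x y : ℝ} (hab : a < b) (ht : 0 < t) (hx : x ∈ Icc a b)
    (hy : y ∈ Icc a b) :
    gaussKernel t (x - y) - gaussKernel t (x + y - 2 * a) - gaussKernel t (x + y - 2 * b) ≤
      dirichletKernel a b t x y := by
  obtain ⟨A, A', B, B', hA, hA', hB, hB', eA, eA', eB, eB', h⟩ := dirichletKernel_split hab ht x y
  obtain ⟨hx1, hx2⟩ := hx
  obtain ⟨hy1, hy2⟩ := hy
  have h1 : ∑' n, B (n + 1) ≤ ∑' n, A n := ((summable_nat_add_iff 1).2 hB).tsum_le_tsum (fun n => by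
    rw [eA, eB]
    refine gaussKernel_le ht ?_
    have : 0 ≤ 2 * (n : ℝ) * (b - a) := by have := sub_pos.2 hab; positivity
    push_cast
    rw [abs_of_nonneg (by linarith), abs_of_nonneg (by linarith)]
    linarith) hA
  have h2 : ∑' n, B' (n + 1) ≤ ∑' n, A' n :=
    ((summable_nat_add_iff 1).2 hB').tsum_le_tsum (fun n => by
      rw [eA', eB']
      refine gaussKernel_le ht ?_
      have : 0 ≤ 2 * (n : ℝ) * (b - a) := by have := sub_pos.2 hab; positivity
      push_cast
      rw [abs_of_nonpos (by linarith), abs_of_nonpos (by linarith)]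
      linarith) hA'
  rw [h, hB.tsum_eq_zero_add, hB'.tsum_eq_zero_add, eB 0, eB' 0]
  simp only [Nat.cast_zero, mul_zero, zero_mul, add_zero, sub_zero]
  linarith

/-- At the centre of the interval the Dirichlet kernel is the Gauss kernel times an alternating
theta series. -/
theorem dirichletKernel_center {x₀ ℓ t : ℝ} (hℓ : 0 < ℓ) (ht : 0 < t) (y : ℝ) :
    dirichletKernel (x₀ - ℓ) (x₀ + ℓ) t x₀ y = gaussKernel t (x₀ - y) *
      altTheta (Real.exp (-(ℓ ^ 2 / t))) (ℓ * |y - x₀| / t) := by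
  set q := Real.exp (-(ℓ ^ 2 / t))
  have hq0 : 0 < q := Real.exp_pos _
  have hq1 : q < 1 := by
    rw [← Real.exp_zero]
    exact Real.exp_lt_exp.2 (neg_lt_zero.2 (by positivity))
  -- Expanding the square separates `j² ℓ² / t`, which gives `q ^ (j ^ 2)`, from the cross term,
  -- which is linear in `j`.
  have hterm : ∀ j : ℤ, (-1 : ℝ) ^ j * gaussKernel t (x₀ - y + 2 * j * ℓ) =
      gaussKernel t (x₀ - y) * ((-1) ^ j * q ^ (j ^ 2) * Real.exp (j * (ℓ * (y - x₀) / t))) := by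
    intro j
    have h1 : q ^ (j ^ 2) = Real.exp (-(ℓ ^ 2 / t) * (j ^ 2 : ℤ)) := by
      rw [← Real.rpow_intCast, ← Real.exp_mul]
    have h2 : Real.exp (-(x₀ - y + 2 * j * ℓ) ^ 2 / (4 * t)) = Real.exp (-(x₀ - y) ^ 2 / (4 * t)) *
        (Real.exp (-(ℓ ^ 2 / t) * (j ^ 2 : ℤ)) * Real.exp (j * (ℓ * (y - x₀) / t))) := by
      rw [← Real.exp_add, ← Real.exp_add]
      congr 1
      push_cast
      field_simp
      ring
    rw [h1, gaussKernel, gaussKernel, h2]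
    ring
  have hsum := (summable_theta_majorant hq0 hq1 (ℓ * (y - x₀) / t))
  have habs : altTheta q (ℓ * |y - x₀| / t) = altTheta q (ℓ * (y - x₀) / t) := by
    rcases abs_choice (y - x₀) with h | h
    · rw [h]
    · rw [h, altTheta, altTheta, ← (Equiv.neg ℤ).tsum_eq]
      refine tsum_congr fun j => ?_
      simp only [Equiv.neg_apply, neg_sq, Int.cast_neg, zpow_neg]
      rw [← inv_zpow, inv_neg, inv_one]
      congr 2
      ring
  rw [habs, altTheta, ← tsum_mul_left]
  simp only [← hterm]
  have hA := (hasSum_int_gaussKernel ht (L := 2 * ℓ) (by positivity) (x₀ - y)).summable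
  have hB := (hasSum_int_gaussKernel ht (L := 2 * ℓ) (by positivity)
    (x₀ + y - 2 * (x₀ - ℓ))).summable
  rw [dirichletKernel, show x₀ + ℓ - (x₀ - ℓ) = 2 * ℓ by ring]
  -- Seen from the centre, all images are spaced by `2ℓ`: even `j` are the positive images, and odd
  -- `j = -(2n + 1)` are the negative ones, up to the sign of the argument.
  have i1 : Function.Injective fun n : ℤ => 2 * n := fun m n h => by simp only at h; lia
  have i2 : Function.Injective fun n : ℤ => -(2 * n + 1) := fun m n h => by simp only at h; lia
  have r1 : range (fun n : ℤ => 2 * n) = {n : ℤ | Even n} := by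
    ext n; simp only [mem_range, mem_ofPred_eq, Int.even_iff]
    exact ⟨fun ⟨m, hm⟩ => by lia, fun h => ⟨n / 2, by lia⟩⟩
  have r2 : range (fun n : ℤ => -(2 * n + 1)) = {n : ℤ | Odd n} := by
    ext n; simp only [mem_range, mem_ofPred_eq, Int.odd_iff]
    exact ⟨fun ⟨m, hm⟩ => by lia, fun h => ⟨(-n - 1) / 2, by lia⟩⟩
  have hc : IsCompl (range fun n : ℤ => 2 * n) (range fun n : ℤ => -(2 * n + 1)) := by
    rw [r1, r2]; exact Int.isCompl_even_odd
  set f : ℤ → ℝ := fun j => (-1 : ℝ) ^ j * gaussKernel t (x₀ - y + 2 * j * ℓ)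
  have g1 : HasSum (f ∘ fun n : ℤ => 2 * n)
      (∑' n : ℤ, gaussKernel t (x₀ - y + 2 * n * (2 * ℓ))) := by
    refine hA.hasSum.congr_fun fun n => ?_
    simp only [f, Function.comp, zpow_mul]
    rw [show (-1 : ℝ) ^ (2 : ℤ) = 1 by norm_num, one_zpow, one_mul]
    congr 1
    push_cast
    ring
  have g2 : HasSum (f ∘ fun n : ℤ => -(2 * n + 1))
      (-∑' n : ℤ, gaussKernel t (x₀ + y - 2 * (x₀ - ℓ) + 2 * n * (2 * ℓ))) := by
    refine hB.hasSum.neg.congr_fun fun n => ?_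
    have : Odd (-(2 * n + 1)) := (odd_two_mul_add_one n).neg
    simp only [f, Function.comp]
    rw [this.neg_one_zpow, neg_one_mul, ← gaussKernel_neg]
    congr 2
    push_cast
    ring
  have g := HasSum.add_isCompl hc (i1.hasSum_range_iff.2 g1) (i2.hasSum_range_iff.2 g2)
  rw [g.tsum_eq, sub_eq_add_neg]

/-! ### Chebyshev's inequality and the lower bound at the centre. -/

theorem integrable_gaussKernel {t : ℝ} (ht : 0 < t) : Integrable (gaussKernel t) := by
  have h := (integrable_exp_neg_mul_sq (b := 1 / (4 * t)) (by positivity)).const_mul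
    ((4 * Real.pi * t) ^ (-(1 / 2) : ℝ))
  refine h.congr (Eventually.of_forall fun z => ?_)
  simp only [gaussKernel]
  congr 2
  ring

theorem integral_gaussKernel {t : ℝ} (ht : 0 < t) : ∫ z, gaussKernel t z = 1 := by
  have h : ∀ z, gaussKernel t z =
      (4 * Real.pi * t) ^ (-(1 / 2) : ℝ) * Real.exp (-(1 / (4 * t)) * z ^ 2) := fun z => by
    rw [gaussKernel]
    congr 2
    ring
  simp only [h]
  rw [integral_const_mul, integral_gaussian, Real.sqrt_eq_rpow]
  have : Real.pi / (1 / (4 * t)) = 4 * Real.pi * t := by field_simp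
  rw [this, ← Real.rpow_add (by positivity)]
  norm_num

theorem integrable_gaussKernel_mul {t : ℝ} (ht : 0 < t) {φ : ℝ → ℝ} {μ : Measure ℝ}
    (hφ : Integrable φ μ) {f : ℝ → ℝ} (hf : Continuous f) :
    Integrable (fun y => gaussKernel t (f y) * φ y) μ := by
  refine Integrable.bdd_mul hφ (c := gaussKernel t 0)
    ((continuous_gaussKernel t).comp hf).aestronglyMeasurable (Eventually.of_forall fun y => ?_)
  rw [Real.norm_of_nonneg (gaussKernel_pos ht _).le]
  exact gaussKernel_le ht (by simp)

theorem integrableOn_dirichletKernel_mul {a b t x : ℝ} (hab : a < b) (ht : 0 < t) {φ : ℝ → ℝ}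
    (hφ : IntegrableOn φ (Ioo a b)) :
    IntegrableOn (fun y => dirichletKernel a b t x y * φ y) (Ioo a b) := by
  have hc := continuous_dirichletKernel hab ht x
  obtain ⟨C, hC⟩ := isCompact_Icc.exists_bound_of_continuousOn (s := Icc a b) hc.continuousOn
  refine Integrable.bdd_mul hφ hc.aestronglyMeasurable (c := C) ?_
  filter_upwards [ae_restrict_mem measurableSet_Ioo] with y hy using hC y (Ioo_subset_Icc_self hy)

/-- A weighted form of Chebyshev's integral inequality. -/
theorem integral_mul_integral_le_of_comonotone {α : Type*} [MeasurableSpace α] {μ : Measure α}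
    {g k φ : α → ℝ} (hg : Integrable g μ) (hk : Integrable k μ)
    (hgφ : Integrable (fun x => g x * φ x) μ) (hkφ : Integrable (fun x => k x * φ x) μ)
    (h : ∀ᵐ x ∂μ, ∀ᵐ y ∂μ, 0 ≤ (k x * g y - g x * k y) * (φ x - φ y)) :
    (∫ x, k x ∂μ) * (∫ x, g x * φ x ∂μ) ≤ (∫ x, g x ∂μ) * (∫ x, k x * φ x ∂μ) := by
  have lin : ∀ c₁ c₂ c₃ c₄ : ℝ, ∫ y, (c₁ * g y - c₂ * (g y * φ y) - c₃ * k y +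
      c₄ * (k y * φ y)) ∂μ = c₁ * ∫ y, g y ∂μ - c₂ * ∫ y, g y * φ y ∂μ - c₃ * ∫ y, k y ∂μ +
      c₄ * ∫ y, k y * φ y ∂μ := fun c₁ c₂ c₃ c₄ => by
    have i1 : Integrable (fun y => c₁ * g y - c₂ * (g y * φ y)) μ :=
      (hg.const_mul _).sub (hgφ.const_mul _)
    have i2 : Integrable (fun y => c₁ * g y - c₂ * (g y * φ y) - c₃ * k y) μ :=
      i1.sub (hk.const_mul _)
    rw [integral_add i2 (hkφ.const_mul _), integral_sub i1 (hk.const_mul _),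
      integral_sub (hg.const_mul _) (hgφ.const_mul _)]
    simp only [integral_const_mul]
  -- The expanded product is integrated in `y` and then in `x`. Each integration is linear in four
  -- fixed functions, so no product measure is needed; the outcome is twice the claim.
  have h1 : ∀ᵐ x ∂μ, 0 ≤ (∫ y, k y * φ y ∂μ) * g x - (∫ y, k y ∂μ) * (g x * φ x) -
      (∫ y, g y * φ y ∂μ) * k x + (∫ y, g y ∂μ) * (k x * φ x) := by
    filter_upwards [h] with x hx
    have h2 : 0 ≤ ∫ y, (k x * φ x * g y - k x * (g y * φ y) - g x * φ x * k y +
        g x * (k y * φ y)) ∂μ :=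
      integral_nonneg_of_ae (hx.mono fun y hy => hy.trans_eq (by ring))
    rw [lin] at h2
    linarith
  have h2 := integral_nonneg_of_ae h1
  rw [lin] at h2
  linarith

theorem integral_cos_nat_mul_pi {a b : ℝ} (hab : a < b) {m : ℕ} (hm : m ≠ 0) :
    ∫ y in a..b, Real.cos (m * Real.pi * (y - a) / (b - a)) = 0 := by
  have hL : b - a ≠ 0 := (sub_pos.2 hab).ne'
  have hm' : (m : ℝ) ≠ 0 := Nat.cast_ne_zero.2 hm
  have hpi := Real.pi_ne_zero
  have hd : ∀ y ∈ uIcc a b, HasDerivAt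
      (fun y => (b - a) / (m * Real.pi) * Real.sin (m * Real.pi * (y - a) / (b - a)))
      (Real.cos (m * Real.pi * (y - a) / (b - a))) y := fun y _ => by
    have h1 := ((((hasDerivAt_id y).sub_const a).const_mul (m * Real.pi)).div_const (b - a)).sin
    refine (h1.const_mul ((b - a) / (m * Real.pi))).congr_deriv ?_
    simp only [id]
    field_simp
  rw [intervalIntegral.integral_eq_sub_of_hasDerivAt hd
    (Continuous.intervalIntegrable (by fun_prop) _ _), sub_self, mul_zero, zero_div, Real.sin_zero,
    mul_div_assoc, div_self hL, mul_one, Real.sin_nat_mul_pi]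
  simp

theorem integral_dirichletEigenfunction_zero_mul {a b : ℝ} (hab : a < b) (k : ℕ) :
    ∫ y in Ioo a b, dirichletEigenfunction a b 0 y * dirichletEigenfunction a b k y =
      if k = 0 then 1 else 0 := by
  have hL : 0 < b - a := sub_pos.2 hab
  have h1 : ∀ y, dirichletEigenfunction a b 0 y * dirichletEigenfunction a b k y =
      1 / (b - a) * (Real.cos (k * Real.pi * (y - a) / (b - a)) -
        Real.cos ((k + 2 : ℕ) * Real.pi * (y - a) / (b - a))) := fun y => by
    have e4 : Real.sqrt (2 / (b - a)) * Real.sqrt (2 / (b - a)) = 2 / (b - a) :=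
      Real.mul_self_sqrt (by positivity)
    have e1 : (k : ℝ) * Real.pi * (y - a) / (b - a) = (k + 1) * Real.pi * (y - a) / (b - a) -
        Real.pi * (y - a) / (b - a) := by ring
    have e2 : ((k + 2 : ℕ) : ℝ) * Real.pi * (y - a) / (b - a) =
        (k + 1) * Real.pi * (y - a) / (b - a) + Real.pi * (y - a) / (b - a) := by
      push_cast; ring
    rw [e1, e2, Real.cos_sub, Real.cos_add, dirichletEigenfunction, dirichletEigenfunction,
      Nat.cast_zero, zero_add, one_mul, mul_mul_mul_comm, e4]
    ring
  simp only [h1]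
  rw [← integral_Ioc_eq_integral_Ioo, ← intervalIntegral.integral_of_le hab.le,
    intervalIntegral.integral_const_mul, intervalIntegral.integral_sub
      (Continuous.intervalIntegrable (by fun_prop) _ _)
      (Continuous.intervalIntegrable (by fun_prop) _ _),
    integral_cos_nat_mul_pi hab (by lia : k + 2 ≠ 0)]
  split_ifs with hk
  · subst hk
    simp [hL.ne']
  · rw [integral_cos_nat_mul_pi hab hk]
    simp

theorem dirichletHeat_eigenfunction_zero {a b : ℝ} (hab : a < b) (t x : ℝ) :
    dirichletHeat a b t (dirichletEigenfunction a b 0) x =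
      Real.exp (-dirichletEigenvalue a b 0 * t) * dirichletEigenfunction a b 0 x := by
  rw [dirichletHeat, tsum_eq_single 0]
  · rw [integral_dirichletEigenfunction_zero_mul hab]
    simp
  · intro k hk
    rw [integral_dirichletEigenfunction_zero_mul hab]
    simp [hk]

/-- This is the condition `q e^s ≤ 1` of the theta lemmas for `q = e^{-ℓ²/t}` and `s = ℓ r / t`: it
holds as long as `y` stays in the interval. -/
theorem exp_neg_sq_div_mul_exp_le {ℓ t r : ℝ} (hℓ : 0 < ℓ) (ht : 0 < t) (hr : r ≤ ℓ) :
    Real.exp (-(ℓ ^ 2 / t)) * Real.exp (ℓ * r / t) ≤ 1 := by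
  rw [← Real.exp_add, ← Real.exp_zero, Real.exp_le_exp]
  have : ℓ * r / t ≤ ℓ ^ 2 / t := by gcongr; nlinarith
  linarith

/-- The probability of surviving in a symmetric interval, started at the centre. -/
theorem exp_le_integral_dirichletKernel_center {x₀ ℓ t : ℝ} (hℓ : 0 < ℓ) (ht : 0 < t) :
    Real.exp (-dirichletEigenvalue (x₀ - ℓ) (x₀ + ℓ) 0 * t) ≤
      ∫ y in Ioo (x₀ - ℓ) (x₀ + ℓ), dirichletKernel (x₀ - ℓ) (x₀ + ℓ) t x₀ y := by
  have hab : x₀ - ℓ < x₀ + ℓ := by linarith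
  have hec : Continuous (dirichletEigenfunction (x₀ - ℓ) (x₀ + ℓ) 0) := by
    unfold dirichletEigenfunction; fun_prop
  have hint : IntegrableOn (dirichletEigenfunction (x₀ - ℓ) (x₀ + ℓ) 0)
      (Ioo (x₀ - ℓ) (x₀ + ℓ)) :=
    (hec.continuousOn.integrableOn_Icc (μ := volume)).mono_set Ioo_subset_Icc_self
  -- The ground state `e₀` is maximal at `x₀` and the kernel `K(x₀, ·)` is nonnegative, so `e^{-λt}
  -- e₀(x₀) = ∫ K e₀ ≤ e₀(x₀) ∫ K`.
  have h := dirichletHeat_eigenfunction_zero hab t x₀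
  rw [dirichletHeat_eq_integral hab ht hint] at h
  have hs : 0 < Real.sqrt (2 / (x₀ + ℓ - (x₀ - ℓ))) :=
    Real.sqrt_pos.2 (div_pos two_pos (by linarith))
  have hx : dirichletEigenfunction (x₀ - ℓ) (x₀ + ℓ) 0 x₀ =
      Real.sqrt (2 / (x₀ + ℓ - (x₀ - ℓ))) := by
    rw [dirichletEigenfunction, Nat.cast_zero, zero_add, one_mul,
      show Real.pi * (x₀ - (x₀ - ℓ)) / (x₀ + ℓ - (x₀ - ℓ)) = Real.pi / 2 by
        have := hℓ.ne'
        rw [div_eq_div_iff (by linarith) two_ne_zero]; ring,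
      Real.sin_pi_div_two, mul_one]
  rw [hx] at h
  refine le_of_mul_le_mul_right ?_ hs
  rw [← h, ← integral_mul_const]
  have hone : IntegrableOn (fun _ => (1 : ℝ)) (Ioo (x₀ - ℓ) (x₀ + ℓ)) := by simp
  have hK := integrableOn_dirichletKernel_mul (x := x₀) hab ht hone
  simp only [mul_one] at hK
  refine setIntegral_mono_on (integrableOn_dirichletKernel_mul hab ht hint) (hK.mul_const _)
    measurableSet_Ioo fun y hy => ?_
  refine mul_le_mul_of_nonneg_left ((le_abs_self _).trans (abs_dirichletEigenfunction_le _ _ _ _)) ?_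
  rw [dirichletKernel_center hℓ ht]
  refine mul_nonneg (gaussKernel_pos ht _).le (altTheta_nonneg (Real.exp_pos _) ?_
    (by positivity) (exp_neg_sq_div_mul_exp_le hℓ ht ?_))
  · rw [← Real.exp_zero]
    exact Real.exp_lt_exp.2 (neg_lt_zero.2 (by positivity))
  · rw [abs_le]; constructor <;> linarith [hy.1, hy.2]

/-- For initial data decreasing away from the centre of the interval, the Dirichlet heat flow at
the centre is controlled by the free heat flow and the first eigenvalue. -/
theorem exp_mul_lineHeat_le_dirichletHeat_center {x₀ ℓ t : ℝ} (hℓ : 0 < ℓ) (ht : 0 < t)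
    {φ : ℝ → ℝ} (hmeas : Measurable φ) (hint : Integrable φ) (hnonneg : ∀ᵐ x, 0 ≤ φ x)
    (hmono : ∀ᵐ x, ∀ᵐ y, |x - x₀| ≤ |y - x₀| → φ y ≤ φ x)
    (hsupp : ∀ᵐ x, x ∉ Ioo (x₀ - ℓ) (x₀ + ℓ) → φ x = 0) :
    Real.exp (-dirichletEigenvalue (x₀ - ℓ) (x₀ + ℓ) 0 * t) * lineHeat t φ x₀ ≤
      dirichletHeat (x₀ - ℓ) (x₀ + ℓ) t φ x₀ := by
  have hab : x₀ - ℓ < x₀ + ℓ := by linarith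
  have hq1 : Real.exp (-(ℓ ^ 2 / t)) < 1 := by
    rw [← Real.exp_zero]
    exact Real.exp_lt_exp.2 (neg_lt_zero.2 (by positivity))
  have hmem : ∀ y ∈ Ioo (x₀ - ℓ) (x₀ + ℓ), |y - x₀| ≤ ℓ := fun y hy => by
    rw [abs_le]; constructor <;> linarith [hy.1, hy.2]
  -- Comonotonicity needs the monotonicity in both orders of `x` and `y`. Exchanging the two a.e.
  -- quantifiers requires a measurable set, hence `hmeas`.
  have hmono' : ∀ᵐ x, ∀ᵐ y, |y - x₀| ≤ |x - x₀| → φ x ≤ φ y := by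
    refine (Measure.ae_ae_comm ?_).1 hmono
    have m1 : MeasurableSet {p : ℝ × ℝ | |p.1 - x₀| ≤ |p.2 - x₀|} :=
      measurableSet_le (by fun_prop) (by fun_prop)
    have m2 : MeasurableSet {p : ℝ × ℝ | φ p.2 ≤ φ p.1} :=
      measurableSet_le (by fun_prop) (by fun_prop)
    convert m1.compl.union m2 using 1
    ext p
    simp [imp_iff_not_or]
  have hline : lineHeat t φ x₀ =
      ∫ y in Ioo (x₀ - ℓ) (x₀ + ℓ), gaussKernel t (x₀ - y) * φ y := by
    rw [lineHeat_eq]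
    refine (setIntegral_eq_integral_of_ae_compl_eq_zero ?_).symm
    filter_upwards [hsupp] with y hy h
    rw [hy h, mul_zero]
  rw [hline, dirichletHeat_eq_integral hab ht hint.integrableOn]
  have hone : IntegrableOn (fun _ => (1 : ℝ)) (Ioo (x₀ - ℓ) (x₀ + ℓ)) := by simp
  have hK := integrableOn_dirichletKernel_mul (x := x₀) hab ht hone
  simp only [mul_one] at hK
  have hg : Integrable fun y => gaussKernel t (x₀ - y) :=
    (integrable_gaussKernel ht).comp_sub_left x₀
  have hg1 : ∫ y in Ioo (x₀ - ℓ) (x₀ + ℓ), gaussKernel t (x₀ - y) ≤ 1 := by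
    rw [← integral_gaussKernel ht, ← integral_sub_left_eq_self (gaussKernel t) volume x₀]
    exact setIntegral_le_integral hg (Eventually.of_forall fun y => (gaussKernel_pos ht _).le)
  have hgφ : Integrable fun y => gaussKernel t (x₀ - y) * φ y :=
    integrable_gaussKernel_mul ht hint (by fun_prop)
  -- The ratio of the Dirichlet to the Gauss kernel is the theta factor, which decreases in `|y -
  -- x₀|` just as `φ` does.
  have hcheb := integral_mul_integral_le_of_comonotone
    (μ := volume.restrict (Ioo (x₀ - ℓ) (x₀ + ℓ))) hg.integrableOn hK hgφ.integrableOn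
    (integrableOn_dirichletKernel_mul (x := x₀) hab ht hint.integrableOn) (by
      filter_upwards [ae_restrict_of_ae hmono, ae_restrict_of_ae hmono',
        ae_restrict_mem measurableSet_Ioo] with x h1 h2 hx
      filter_upwards [ae_restrict_of_ae h1, ae_restrict_of_ae h2,
        ae_restrict_mem measurableSet_Ioo] with y h3 h4 hy
      rw [dirichletKernel_center hℓ ht, dirichletKernel_center hℓ ht]
      have hgx := gaussKernel_pos ht (x₀ - x)
      have hgy := gaussKernel_pos ht (x₀ - y)
      have key : ∀ u v : ℝ, |u - x₀| ≤ |v - x₀| → |v - x₀| ≤ ℓ →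
          altTheta (Real.exp (-(ℓ ^ 2 / t))) (ℓ * |v - x₀| / t) ≤
            altTheta (Real.exp (-(ℓ ^ 2 / t))) (ℓ * |u - x₀| / t) := fun u v huv hv =>
        altTheta_antitone (Real.exp_pos _) hq1 (by positivity) (by gcongr)
          (exp_neg_sq_div_mul_exp_le hℓ ht hv)
      set θx := altTheta (Real.exp (-(ℓ ^ 2 / t))) (ℓ * |x - x₀| / t)
      set θy := altTheta (Real.exp (-(ℓ ^ 2 / t))) (ℓ * |y - x₀| / t)
      have e : (gaussKernel t (x₀ - x) * θx * gaussKernel t (x₀ - y) -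
          gaussKernel t (x₀ - x) * (gaussKernel t (x₀ - y) * θy)) * (φ x - φ y) =
          gaussKernel t (x₀ - x) * gaussKernel t (x₀ - y) * ((θx - θy) * (φ x - φ y)) := by ring
      rw [e]
      refine mul_nonneg (mul_pos hgx hgy).le ?_
      rcases le_total |x - x₀| |y - x₀| with h | h
      · exact mul_nonneg (sub_nonneg.2 (key x y h (hmem y hy))) (sub_nonneg.2 (h3 h))
      · exact mul_nonneg_of_nonpos_of_nonpos (sub_nonpos.2 (key y x h (hmem x hx)))
          (sub_nonpos.2 (h4 h)))
  have h1 := exp_le_integral_dirichletKernel_center (x₀ := x₀) hℓ ht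
  have h2 : 0 ≤ ∫ y in Ioo (x₀ - ℓ) (x₀ + ℓ), gaussKernel t (x₀ - y) * φ y :=
    integral_nonneg_of_ae (ae_restrict_of_ae (hnonneg.mono fun y hy =>
      mul_nonneg (gaussKernel_pos ht _).le hy))
  have h3 : 0 ≤ ∫ y in Ioo (x₀ - ℓ) (x₀ + ℓ), dirichletKernel (x₀ - ℓ) (x₀ + ℓ) t x₀ y * φ y := by
    refine integral_nonneg_of_ae ?_
    filter_upwards [ae_restrict_of_ae hnonneg, ae_restrict_mem measurableSet_Ioo] with y hy hyI
    refine mul_nonneg ?_ hy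
    rw [dirichletKernel_center hℓ ht]
    exact mul_nonneg (gaussKernel_pos ht _).le (altTheta_nonneg (Real.exp_pos _) hq1
      (by positivity) (exp_neg_sq_div_mul_exp_le hℓ ht (hmem y hyI)))
  calc _ ≤ _ := mul_le_mul_of_nonneg_right h1 h2
    _ ≤ _ := hcheb
    _ ≤ _ := mul_le_of_le_one_left h3 hg1

/-! ### Closeness of the Dirichlet and free flows. -/

/-- From `e^{-u} ≤ 1/u` with `u = z² / (4t)`. One bound serves both limits, `t → 0` and `z → ∞`. -/
theorem gaussKernel_le_sqrt {t z : ℝ} (ht : 0 < t) (hz : z ≠ 0) :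
    gaussKernel t z ≤ 4 * Real.sqrt t / z ^ 2 := by
  have hz2 : 0 < z ^ 2 := by positivity
  have hst : 0 < Real.sqrt t := Real.sqrt_pos.2 ht
  have h1 : (4 * Real.pi * t) ^ (-(1 / 2) : ℝ) ≤ (Real.sqrt t)⁻¹ := by
    rw [Real.rpow_neg (by positivity), ← Real.sqrt_eq_rpow]
    gcongr
    nlinarith [Real.pi_gt_three]
  have h2 : Real.exp (-z ^ 2 / (4 * t)) ≤ 4 * t / z ^ 2 := by
    have h3 := (Real.add_one_le_exp (z ^ 2 / (4 * t)))
    have h4 : 0 < z ^ 2 / (4 * t) := by positivity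
    rw [neg_div, Real.exp_neg, ← inv_div (z ^ 2) (4 * t)]
    exact inv_anti₀ h4 (by linarith)
  calc gaussKernel t z ≤ (Real.sqrt t)⁻¹ * (4 * t / z ^ 2) :=
        mul_le_mul h1 h2 (Real.exp_pos _).le (by positivity)
    _ = 4 * Real.sqrt t / z ^ 2 := by
        have := Real.mul_self_sqrt ht.le
        field_simp
        linarith

theorem tendsto_gaussKernel_time_zero {z : ℝ} (hz : z ≠ 0) :
    Tendsto (fun t => gaussKernel t z) (𝓝[>] 0) (𝓝 0) := by
  have h : Tendsto (fun t : ℝ => 4 * Real.sqrt t / z ^ 2) (𝓝[>] 0) (𝓝 0) := by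
    have : Continuous fun t : ℝ => 4 * Real.sqrt t / z ^ 2 := by fun_prop
    simpa using (this.tendsto 0).mono_left nhdsWithin_le_nhds
  refine squeeze_zero' ?_ ?_ h
  · filter_upwards [self_mem_nhdsWithin] with t ht using (gaussKernel_pos ht z).le
  · filter_upwards [self_mem_nhdsWithin] with t ht using gaussKernel_le_sqrt ht hz

theorem tendsto_gaussKernel_atTop {t : ℝ} (ht : 0 < t) :
    Tendsto (gaussKernel t) atTop (𝓝 0) := by
  have h : Tendsto (fun z : ℝ => 4 * Real.sqrt t / z ^ 2) atTop (𝓝 0) :=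
    tendsto_const_nhds.div_atTop (tendsto_pow_atTop two_ne_zero)
  refine squeeze_zero' (Eventually.of_forall fun z => (gaussKernel_pos ht z).le) ?_ h
  filter_upwards [eventually_ne_atTop 0] with z hz using gaussKernel_le_sqrt ht hz

theorem integral_mul_le_dirichletHeat {a b c d t x : ℝ} (hab : a < b) (hac : a < c) (hdb : d < b)
    (ht : 0 < t) {φ f : ℝ → ℝ} (hφ : Integrable φ) (hnonneg : ∀ᵐ y, 0 ≤ φ y)
    (hsupp : ∀ᵐ y, y ∉ Icc c d → φ y = 0) (hfφ : Integrable fun y => f y * φ y)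
    (hf : ∀ y ∈ Icc c d, f y ≤ dirichletKernel a b t x y) :
    ∫ y, f y * φ y ≤ dirichletHeat a b t φ x := by
  have h1 : ∫ y, f y * φ y = ∫ y in Ioo a b, f y * φ y := by
    refine (setIntegral_eq_integral_of_ae_compl_eq_zero ?_).symm
    filter_upwards [hsupp] with y hy h
    rw [hy fun hy' => h (Icc_subset_Ioo hac hdb hy'), mul_zero]
  rw [h1, dirichletHeat_eq_integral hab ht hφ.integrableOn]
  refine integral_mono_ae hfφ.integrableOn
    (integrableOn_dirichletKernel_mul hab ht hφ.integrableOn) (ae_restrict_of_ae ?_)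
  filter_upwards [hnonneg, hsupp] with y h0 hy
  by_cases h : y ∈ Icc c d
  · exact mul_le_mul_of_nonneg_right (hf y h) h0
  · simp [hy h]

/-- As the data live in `[c, d]`, the two nearest reflected images stay at distance at least `c - a`
and `b - d`, whatever `x` is. The error is thus uniform in `x`. -/
theorem lineHeat_sub_le_dirichletHeat {a b c d t x : ℝ} (hac : a < c) (hcd : c ≤ d) (hdb : d < b)
    (ht : 0 < t) (hx : x ∈ Icc a b) {φ : ℝ → ℝ} (hφ : Integrable φ) (hnonneg : ∀ᵐ y, 0 ≤ φ y)
    (hsupp : ∀ᵐ y, y ∉ Icc c d → φ y = 0) :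
    lineHeat t φ x - (gaussKernel t (c - a) + gaussKernel t (b - d)) * ∫ y, φ y ≤
      dirichletHeat a b t φ x := by
  have hab : a < b := by linarith
  have hg := integrable_gaussKernel_mul ht hφ (f := fun y => x - y) (by fun_prop)
  rw [lineHeat_eq, ← integral_const_mul, ← integral_sub hg (hφ.const_mul _)]
  simp only [← sub_mul]
  refine integral_mul_le_dirichletHeat hab hac hdb ht hφ hnonneg hsupp ?_ fun y hy => ?_
  · simp only [sub_mul]
    exact hg.sub (hφ.const_mul _)
  · have h := le_dirichletKernel hab ht hx (Icc_subset_Icc hac.le hdb.le hy)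
    have h1 : gaussKernel t (x + y - 2 * a) ≤ gaussKernel t (c - a) := gaussKernel_le ht (by
      rw [abs_of_pos (by linarith), abs_of_nonneg (by linarith [hx.1, hy.1])]
      linarith [hx.1, hy.1])
    have h2 : gaussKernel t (x + y - 2 * b) ≤ gaussKernel t (b - d) := gaussKernel_le ht (by
      rw [abs_of_pos (by linarith), abs_of_nonpos (by linarith [hx.2, hy.2])]
      linarith [hx.2, hy.2])
    linarith

theorem lineHeat_nonneg {t : ℝ} (ht : 0 < t) {φ : ℝ → ℝ} (hnonneg : ∀ᵐ y, 0 ≤ φ y) (x : ℝ) :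
    0 ≤ lineHeat t φ x := by
  rw [lineHeat_eq]
  exact integral_nonneg_of_ae (hnonneg.mono fun y hy => mul_nonneg (gaussKernel_pos ht _).le hy)

theorem dirichletHeat_le_lineHeat {a b t x : ℝ} (hab : a < b) (ht : 0 < t) (hx : x ∈ Icc a b)
    {φ : ℝ → ℝ} (hφ : Integrable φ) (hnonneg : ∀ᵐ y, 0 ≤ φ y) :
    dirichletHeat a b t φ x ≤ lineHeat t φ x := by
  have hg := integrable_gaussKernel_mul ht hφ (f := fun y => x - y) (by fun_prop)
  rw [dirichletHeat_eq_integral hab ht hφ.integrableOn, lineHeat_eq]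
  refine le_trans ?_ (setIntegral_le_integral (s := Ioo a b) hg
    (hnonneg.mono fun y hy => mul_nonneg (gaussKernel_pos ht _).le hy))
  refine integral_mono_ae (integrableOn_dirichletKernel_mul hab ht hφ.integrableOn)
    hg.integrableOn ?_
  filter_upwards [ae_restrict_of_ae hnonneg, ae_restrict_mem measurableSet_Ioo] with y h0 hy
  exact mul_le_mul_of_nonneg_right (dirichletKernel_le hab ht hx (Ioo_subset_Icc_self hy)) h0

/-- For small times the Dirichlet and the free heat flows are uniformly close. -/
theorem exists_lineHeat_sub_le_dirichletHeat {a b c d : ℝ} (hac : a < c) (hcd : c ≤ d)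
    (hdb : d < b) {φ : ℝ → ℝ} (hφ : Integrable φ) (hnonneg : ∀ᵐ y, 0 ≤ φ y)
    (hsupp : ∀ᵐ y, y ∉ Icc c d → φ y = 0) {ε : ℝ} (hε : 0 < ε) :
    ∃ τ, 0 < τ ∧ ∀ t ∈ Ioo 0 τ, ∀ x ∈ Icc a b,
      lineHeat t φ x - ε ≤ dirichletHeat a b t φ x := by
  have h := ((tendsto_gaussKernel_time_zero (z := c - a) (by linarith)).add
    (tendsto_gaussKernel_time_zero (z := b - d) (by linarith))).mul_const (∫ y, φ y)
  rw [add_zero, zero_mul] at h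
  obtain ⟨τ, hτ, hτ'⟩ := mem_nhdsGT_iff_exists_Ioo_subset.1 (h.eventually_lt_const hε)
  refine ⟨τ, hτ, fun t ht x hx => ?_⟩
  have h1 := lineHeat_sub_le_dirichletHeat hac hcd hdb ht.1 hx hφ hnonneg hsupp
  have h2 := hτ' ht
  simp only [mem_ofPred_eq] at h2
  linarith

/-! ### Comparison of heat flows and monotonicity in the domain. -/

/-- For `v ≥ 0` the damped function `e^{-λt} v` is a subsolution, the defect being `λ e^{-λt} v ≥
0`. With `lam = 0` this is the ordinary comparison principle. -/
theorem IsHeatSolution.exp_mul_le_of_boundary {u v : ℝ → ℝ → ℝ} (hu : IsHeatSolution u)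
    (hv : IsHeatSolution v) {a b lam : ℝ} (hlam : 0 ≤ lam)
    (hv0 : ∀ t, 0 < t → ∀ x ∈ Icc a b, 0 ≤ v t x)
    (ha : ∀ t, 0 < t → Real.exp (-lam * t) * v t a ≤ u t a)
    (hb : ∀ t, 0 < t → Real.exp (-lam * t) * v t b ≤ u t b)
    (hinit : ∀ ε, 0 < ε → ∃ τ, 0 < τ ∧ ∀ t ∈ Ioo 0 τ, ∀ x ∈ Icc a b, v t x - ε ≤ u t x)
    {t x : ℝ} (ht : 0 < t) (hx : x ∈ Icc a b) : Real.exp (-lam * t) * v t x ≤ u t x := by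
  obtain ⟨hcu, ux, uxx, hu⟩ := hu
  obtain ⟨hcv, vx, vxx, hv⟩ := hv
  have hexp : ∀ t, HasDerivAt (fun s => Real.exp (-lam * s)) (Real.exp (-lam * t) * -lam) t :=
    fun t => by simpa using ((hasDerivAt_id t).const_mul (-lam)).exp
  refine sub_nonneg.1 (parabolic_minimum_principle (a := a) (b := b)
    (W := fun t x => u t x - Real.exp (-lam * t) * v t x)
    (Wt := fun t x => uxx t x - (Real.exp (-lam * t) * -lam * v t x + Real.exp (-lam * t) * vxx t x))
    (Wx := fun t x => ux t x - Real.exp (-lam * t) * vx t x)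
    (Wxx := fun t x => uxx t x - Real.exp (-lam * t) * vxx t x)
    ?_ (fun t ht x _ => (hu t ht x).2.2.sub ((hexp t).mul (hv t ht x).2.2))
    (fun t ht x _ => (hu t ht x).1.sub ((hv t ht x).1.const_mul _))
    (fun t ht x _ => (hu t ht x).2.1.sub ((hv t ht x).2.1.const_mul _))
    (fun t ht x hx => ?_) (fun t ht => sub_nonneg.2 (ha t ht)) (fun t ht => sub_nonneg.2 (hb t ht))
    (fun ε hε => ?_) ht hx)
  · refine ContinuousOn.mono ?_ (prod_mono le_rfl (subset_univ _))
    exact hcu.sub (ContinuousOn.mul (f := fun p : ℝ × ℝ => Real.exp (-lam * p.1)) (by fun_prop) hcv)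
  · have := mul_nonneg (mul_nonneg (Real.exp_pos (-lam * t)).le hlam)
      (hv0 t ht x (Ioo_subset_Icc_self hx))
    linarith
  · obtain ⟨τ, hτ, h⟩ := hinit ε hε
    refine ⟨τ, hτ, fun t ht x hx => ?_⟩
    have h1 : Real.exp (-lam * t) * v t x ≤ v t x := mul_le_of_le_one_left (hv0 t ht.1 x hx) (by
      rw [← Real.exp_zero]
      exact Real.exp_le_exp.2 (by nlinarith [mul_nonneg hlam ht.1.le]))
    have := h t ht x hx
    linarith

theorem isHeatSolution_zero : IsHeatSolution fun _ _ => 0 :=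
  ⟨continuousOn_const, fun _ _ => 0, fun _ _ => 0, fun _ _ _ =>
    ⟨hasDerivAt_const _ _, hasDerivAt_const _ _, hasDerivAt_const _ _⟩⟩

theorem dirichletHeat_nonneg {a b c d t x : ℝ} (hac : a < c) (hcd : c ≤ d) (hdb : d < b)
    (ht : 0 < t) (hx : x ∈ Icc a b) {φ : ℝ → ℝ} (hφ : Integrable φ) (hnonneg : ∀ᵐ y, 0 ≤ φ y)
    (hsupp : ∀ᵐ y, y ∉ Icc c d → φ y = 0) : 0 ≤ dirichletHeat a b t φ x := by
  have hab : a < b := by linarith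
  have h := (isHeatSolution_dirichletHeat hab hφ.integrableOn).exp_mul_le_of_boundary
    isHeatSolution_zero (a := a) (b := b) (lam := 0) le_rfl (fun _ _ _ _ => le_rfl)
    (fun t _ => by rw [dirichletHeat_left hab, mul_zero])
    (fun t _ => by rw [dirichletHeat_right hab, mul_zero]) (fun ε hε => by
      obtain ⟨τ, hτ, h⟩ := exists_lineHeat_sub_le_dirichletHeat hac hcd hdb hφ hnonneg hsupp hε
      refine ⟨τ, hτ, fun t ht x hx => le_trans ?_ (h t ht x hx)⟩
      linarith [lineHeat_nonneg ht.1 hnonneg x]) ht hx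
  simpa using h

/-- Monotonicity of the Dirichlet heat flow with respect to the domain. -/
theorem dirichletHeat_mono_domain {a b a' b' c d t x : ℝ} (haa : a ≤ a') (hac : a' < c)
    (hcd : c ≤ d) (hdb : d < b') (hbb : b' ≤ b) (ht : 0 < t) (hx : x ∈ Icc a' b') {φ : ℝ → ℝ}
    (hφ : Integrable φ) (hnonneg : ∀ᵐ y, 0 ≤ φ y) (hsupp : ∀ᵐ y, y ∉ Icc c d → φ y = 0) :
    dirichletHeat a' b' t φ x ≤ dirichletHeat a b t φ x := by
  have hab : a < b := by linarith
  have hab' : a' < b' := by linarith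
  have hsub : Icc a' b' ⊆ Icc a b := Icc_subset_Icc haa hbb
  have hac' : a < c := haa.trans_lt hac
  have hdb' : d < b := hdb.trans_le hbb
  have h := (isHeatSolution_dirichletHeat hab hφ.integrableOn).exp_mul_le_of_boundary
    (isHeatSolution_dirichletHeat hab' hφ.integrableOn) (a := a') (b := b') (lam := 0) le_rfl
    (fun t ht x hx => dirichletHeat_nonneg hac hcd hdb ht hx hφ hnonneg hsupp)
    (fun t ht => by
      rw [dirichletHeat_left hab', mul_zero]
      exact dirichletHeat_nonneg hac' hcd hdb' ht (hsub (left_mem_Icc.2 hab'.le)) hφ hnonneg hsupp)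
    (fun t ht => by
      rw [dirichletHeat_right hab', mul_zero]
      exact dirichletHeat_nonneg hac' hcd hdb' ht (hsub (right_mem_Icc.2 hab'.le)) hφ hnonneg hsupp)
    -- Initially the free flow separates the two: the smaller domain's flow lies below it, and the
    -- larger domain's flow is at most `ε` beneath it.
    (fun ε hε => by
      obtain ⟨τ, hτ, h⟩ := exists_lineHeat_sub_le_dirichletHeat hac' hcd hdb' hφ hnonneg hsupp hε
      refine ⟨τ, hτ, fun t ht x hx => le_trans ?_ (h t ht x (hsub hx))⟩
      linarith [dirichletHeat_le_lineHeat hab' ht.1 hx hφ hnonneg]) ht hx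
  simpa using h

/-! ### The estimate to the right of the centre. -/

/-- Lower bound near the right end point: the left end point only contributes an error that is
small when it is far away. -/
theorem one_sub_exp_mul_lineHeat_sub_le_dirichletHeat {a b c d t x : ℝ} (hac : a < c) (hcd : c ≤ d)
    (hdb : d < b) (ht : 0 < t) (hx : x ∈ Icc c b) {φ : ℝ → ℝ} (hφ : Integrable φ)
    (hnonneg : ∀ᵐ y, 0 ≤ φ y) (hsupp : ∀ᵐ y, y ∉ Icc c d → φ y = 0) :
    (1 - Real.exp (-(b - d) * (b - x) / t)) * lineHeat t φ x -
      gaussKernel t (c - a) * ∫ y, φ y ≤ dirichletHeat a b t φ x := by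
  have hab : a < b := by linarith
  have hg := integrable_gaussKernel_mul ht hφ (f := fun y => x - y) (by fun_prop)
  set q := Real.exp (-(b - d) * (b - x) / t) with hq
  rw [lineHeat_eq, ← integral_const_mul, ← integral_const_mul,
    ← integral_sub (hg.const_mul _) (hφ.const_mul _)]
  simp only [← mul_assoc, ← sub_mul]
  refine integral_mul_le_dirichletHeat hab hac hdb ht hφ hnonneg hsupp ?_ fun y hy => ?_
  · simp only [sub_mul _ _ (φ _), mul_assoc]
    exact (hg.const_mul _).sub (hφ.const_mul _)
  · have h := le_dirichletKernel hab ht (Icc_subset_Icc_left hac.le hx)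
      (Icc_subset_Icc hac.le hdb.le hy)
    have h1 : gaussKernel t (x + y - 2 * a) ≤ gaussKernel t (c - a) := gaussKernel_le ht (by
      rw [abs_of_pos (by linarith), abs_of_nonneg (by linarith [hx.1, hy.1])]
      linarith [hx.1, hy.1])
    -- Since `(x + y - 2b)² - (x - y)² = 4 (b - x)(b - y)`, the ratio of the two Gaussians is
    -- `e^{-(b-y)(b-x)/t}`, and `y ≤ d` on the support.
    have h2 : gaussKernel t (x + y - 2 * b) ≤ q * gaussKernel t (x - y) := by
      have h3 : gaussKernel t (x + y - 2 * b) =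
          Real.exp (-(b - y) * (b - x) / t) * gaussKernel t (x - y) := by
        rw [gaussKernel, gaussKernel, mul_left_comm, ← Real.exp_add]
        congr 2
        field_simp
        ring
      rw [h3, hq]
      refine mul_le_mul_of_nonneg_right (Real.exp_le_exp.2 ?_) (gaussKernel_pos ht _).le
      have := mul_le_mul_of_nonneg_right (show b - d ≤ b - y by linarith [hy.2])
        (sub_nonneg.2 hx.2)
      gcongr ?_ / t
      linarith
    linarith

theorem exp_mul_lineHeat_le_dirichletHeat_right {R x₀ t x : ℝ} (hl : -R < x₀ - 1) (hr : x₀ + 1 < R)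
    {φ : ℝ → ℝ} (hmeas : Measurable φ) (hint : Integrable φ) (hnonneg : ∀ᵐ x, 0 ≤ φ x)
    (hmono : ∀ᵐ x, ∀ᵐ y, |x - x₀| ≤ |y - x₀| → φ y ≤ φ x)
    (hsupp : ∀ᵐ y, y ∉ Icc (x₀ - 1) (x₀ + 1) → φ y = 0) (ht : 0 < t) (hx : x₀ ≤ x) (hxR : x ≤ R) :
    Real.exp (-(Real.pi / (2 * (R - |x₀|))) ^ 2 * t) *
      (1 - Real.exp (-(R - x₀ - 1) * (R - x) / t)) * lineHeat t φ x ≤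
        dirichletHeat (-R) R t φ x := by
  set ℓ := R - |x₀| with hℓ
  have hℓ1 : 1 < ℓ := by
    rw [hℓ]; cases abs_cases x₀ <;> linarith
  have hball : -R ≤ x₀ - ℓ ∧ x₀ + ℓ ≤ R := by
    rw [hℓ]; constructor <;> cases abs_cases x₀ <;> linarith
  have hlam : dirichletEigenvalue (x₀ - ℓ) (x₀ + ℓ) 0 = (Real.pi / (2 * ℓ)) ^ 2 := by
    rw [dirichletEigenvalue, Nat.cast_zero, zero_add, one_mul,
      show x₀ + ℓ - (x₀ - ℓ) = 2 * ℓ by ring]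
  set lam := (Real.pi / (2 * ℓ)) ^ 2
  have hsupp' : ∀ᵐ y, y ∉ Ioo (x₀ - ℓ) (x₀ + ℓ) → φ y = 0 := by
    filter_upwards [hsupp] with y hy h
    exact hy fun h' => h (Icc_subset_Ioo (by linarith) (by linarith) h')
  have hR : -R < R := by linarith
  -- The interval `(x₀ - ℓ, x₀ + ℓ)` is the largest one centred at `x₀` inside `(-R, R)`, which is
  -- where `λ_ℓ` comes from.
  have hcenter : ∀ s, 0 < s → Real.exp (-lam * s) * lineHeat s φ x₀ ≤
      dirichletHeat (-R) R s φ x₀ := fun s hs => by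
    rw [← hlam]
    refine (exp_mul_lineHeat_le_dirichletHeat_center (by linarith) hs hmeas hint hnonneg hmono
      hsupp').trans ?_
    exact dirichletHeat_mono_domain hball.1 (by linarith) (by linarith : x₀ - 1 ≤ x₀ + 1)
      (by linarith) hball.2 hs ⟨by linarith, by linarith⟩ hint hnonneg hsupp
  -- The interval `(-(R + n), R)` replaces the half-line `(-∞, R)`. On `[x₀, R]` both flows vanish
  -- at `R`, and at `x₀` the bound `hcenter` applies because the free flow dominates.
  have hcomp : ∀ n : ℕ, Real.exp (-lam * t) * dirichletHeat (-(R + n)) R t φ x ≤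
      dirichletHeat (-R) R t φ x := fun n => by
    have hn : (0 : ℝ) ≤ n := Nat.cast_nonneg n
    have hRn : -(R + n) < R := by linarith
    have hsub : Icc x₀ R ⊆ Icc (-(R + n)) R := Icc_subset_Icc_left (by linarith)
    refine (isHeatSolution_dirichletHeat hR hint.integrableOn).exp_mul_le_of_boundary
      (isHeatSolution_dirichletHeat hRn hint.integrableOn) (a := x₀) (b := R) (sq_nonneg _)
      (fun s hs y hy => dirichletHeat_nonneg (by linarith) (by linarith : x₀ - 1 ≤ x₀ + 1) hr hs
        (hsub hy) hint hnonneg hsupp)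
      (fun s hs => ?_)
      (fun s hs => by rw [dirichletHeat_right hRn, dirichletHeat_right hR, mul_zero])
      (fun ε hε => ?_) ht ⟨hx, hxR⟩
    · refine le_trans (mul_le_mul_of_nonneg_left ?_ (Real.exp_pos _).le) (hcenter s hs)
      exact dirichletHeat_le_lineHeat hRn hs (hsub ⟨le_rfl, by linarith⟩) hint hnonneg
    · obtain ⟨τ, hτ, h⟩ := exists_lineHeat_sub_le_dirichletHeat hl
        (by linarith : x₀ - 1 ≤ x₀ + 1) hr hint hnonneg hsupp hε
      refine ⟨τ, hτ, fun s hs y hy => le_trans ?_ (h s hs y ⟨by linarith [hy.1], hy.2⟩)⟩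
      linarith [dirichletHeat_le_lineHeat hRn hs.1 (hsub hy) hint hnonneg]
  -- As the left end point recedes, its reflected image contributes nothing in the limit.
  have hlim : Tendsto (fun n : ℕ => Real.exp (-lam * t) *
      ((1 - Real.exp (-(R - (x₀ + 1)) * (R - x) / t)) * lineHeat t φ x -
        gaussKernel t (x₀ - 1 - -(R + n)) * ∫ y, φ y)) atTop
      (𝓝 (Real.exp (-lam * t) *
        ((1 - Real.exp (-(R - (x₀ + 1)) * (R - x) / t)) * lineHeat t φ x - 0 * ∫ y, φ y))) := by
    refine Tendsto.const_mul _ (tendsto_const_nhds.sub (Tendsto.mul_const _ ?_))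
    refine (tendsto_gaussKernel_atTop ht).comp ?_
    have h := tendsto_atTop_add_const_left atTop (x₀ - 1 + R) (tendsto_natCast_atTop_atTop (R := ℝ))
    refine h.congr fun n => ?_
    ring
  rw [zero_mul, sub_zero, ← mul_assoc, ← sub_sub] at hlim
  refine le_of_tendsto' hlim fun n => le_trans (mul_le_mul_of_nonneg_left ?_ (Real.exp_pos _).le)
    (hcomp n)
  have hn : (0 : ℝ) ≤ n := Nat.cast_nonneg n
  rw [sub_sub]
  exact one_sub_exp_mul_lineHeat_sub_le_dirichletHeat (by linarith) (by linarith) hr ht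
    ⟨by linarith, hxR⟩ hint hnonneg hsupp

/-! ### Reflection symmetry and conclusion. -/

theorem dirichletEigenfunction_neg {R : ℝ} (hR : 0 < R) (k : ℕ) (y : ℝ) :
    dirichletEigenfunction (-R) R k (-y) = -(-1) ^ (k + 1) * dirichletEigenfunction (-R) R k y := by
  have h : ((k : ℝ) + 1) * Real.pi * (-y - -R) / (R - -R) =
      ((k + 1 : ℕ) : ℝ) * Real.pi - (k + 1) * Real.pi * (y - -R) / (R - -R) := by
    push_cast
    field_simp
    ring
  rw [dirichletEigenfunction, h, Real.sin_nat_mul_pi_sub, dirichletEigenfunction]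
  ring

theorem dirichletHeat_comp_neg {R : ℝ} (hR : 0 < R) (t : ℝ) (φ : ℝ → ℝ) (x : ℝ) :
    dirichletHeat (-R) R t (fun y => φ (-y)) (-x) = dirichletHeat (-R) R t φ x := by
  refine tsum_congr fun k => ?_
  have h : ∫ y in Ioo (-R) R, φ (-y) * dirichletEigenfunction (-R) R k y =
      -(-1) ^ (k + 1) * ∫ y in Ioo (-R) R, φ y * dirichletEigenfunction (-R) R k y := by
    rw [← integral_Ioc_eq_integral_Ioo, ← integral_Ioc_eq_integral_Ioo,
      ← intervalIntegral.integral_of_le (by linarith), ← intervalIntegral.integral_of_le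
      (by linarith), ← intervalIntegral.integral_const_mul]
    have h1 := intervalIntegral.integral_comp_neg (a := -R) (b := R)
      fun y => φ y * dirichletEigenfunction (-R) R k (-y)
    simp only [neg_neg] at h1
    rw [h1]
    refine intervalIntegral.integral_congr fun y _ => ?_
    simp only [dirichletEigenfunction_neg hR]
    ring
  rw [h, dirichletEigenfunction_neg hR]
  have h2 : (-(-1 : ℝ) ^ (k + 1)) * (-(-1) ^ (k + 1)) = 1 := by
    rw [neg_mul_neg, ← mul_pow]
    simp
  linear_combination (Real.exp (-dirichletEigenvalue (-R) R k * t) *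
    (∫ y in Ioo (-R) R, φ y * dirichletEigenfunction (-R) R k y) *
      dirichletEigenfunction (-R) R k x) * h2

theorem lineHeat_comp_neg (t : ℝ) (φ : ℝ → ℝ) (x : ℝ) :
    lineHeat t (fun y => φ (-y)) (-x) = lineHeat t φ x := by
  rw [lineHeat_eq, lineHeat_eq, ← integral_neg_eq_self]
  refine integral_congr_ae (Eventually.of_forall fun y => ?_)
  simp only [neg_neg]
  rw [← gaussKernel_neg]
  ring_nf

theorem dirichletHeat_congr_ae {a b t : ℝ} {φ ψ : ℝ → ℝ} (h : φ =ᵐ[volume] ψ) (x : ℝ) :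
    dirichletHeat a b t φ x = dirichletHeat a b t ψ x := by
  refine tsum_congr fun k => ?_
  have : ∫ y in Ioo a b, φ y * dirichletEigenfunction a b k y =
      ∫ y in Ioo a b, ψ y * dirichletEigenfunction a b k y :=
    integral_congr_ae (ae_restrict_of_ae (h.mono fun y hy => by simp only [hy]))
  rw [this]

theorem lineHeat_congr_ae {t : ℝ} {φ ψ : ℝ → ℝ} (h : φ =ᵐ[volume] ψ) (x : ℝ) :
    lineHeat t φ x = lineHeat t ψ x :=
  integral_congr_ae (h.mono fun y hy => by simp only [hy])

theorem proposition7p1 (R x₀ ℓ d₁ d₂ lam : ℝ)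
    (hI : closure (Ioo (x₀ - 1) (x₀ + 1)) ⊆ Ioo (-R) R)
    (hℓ : ℓ = R - |x₀|) (hd₁ : d₁ = R - x₀ - 1) (hd₂ : d₂ = R + x₀ - 1)
    (hlam : lam = (Real.pi / (2 * ℓ)) ^ 2)
    (φ : ℝ → ℝ) (hφ : MemLp φ ∞ volume)
    (hnonneg : ∀ᵐ x, 0 ≤ φ x)
    (hsymm : ∀ᵐ x, φ (2 * x₀ - x) = φ x)
    (hmono : ∀ᵐ x, ∀ᵐ y, |x - x₀| ≤ |y - x₀| → φ y ≤ φ x)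
    (hsupp : ∀ᵐ x, x ∉ Ioo (x₀ - 1) (x₀ + 1) → φ x = 0)
    (t : ℝ) (ht : 0 < t) :
    (∀ x, x₀ ≤ x → x ≤ R →
      Real.exp (-lam * t) * (1 - Real.exp (-d₁ * (R - x) / t)) * lineHeat t φ x
        ≤ dirichletHeat (-R) R t φ x) ∧
    (∀ x, -R ≤ x → x ≤ x₀ →
      Real.exp (-lam * t) * (1 - Real.exp (-d₂ * (R + x) / t)) * lineHeat t φ x
        ≤ dirichletHeat (-R) R t φ x) := by
  subst hℓ hd₁ hd₂ hlam
  rw [closure_Ioo (by linarith)] at hI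
  have hl : -R < x₀ - 1 := (hI (left_mem_Icc.2 (by linarith))).1
  have hr : x₀ + 1 < R := (hI (right_mem_Icc.2 (by linarith))).2
  have hint : Integrable φ := by
    refine IntegrableOn.integrable_of_ae_notMem_eq_zero (s := Ioo (x₀ - 1) (x₀ + 1)) ?_ hsupp
    exact (hφ.restrict _).integrable le_top
  -- A measurable representative is needed for the exchange of a.e. quantifiers; neither flow sees
  -- the change.
  obtain ⟨ψ, hψm, hψ⟩ : ∃ ψ : ℝ → ℝ, Measurable ψ ∧ φ =ᵐ[volume] ψ :=
    ⟨hφ.1.mk φ, hφ.1.stronglyMeasurable_mk.measurable, hφ.1.ae_eq_mk⟩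
  have hint' : Integrable ψ := hint.congr hψ
  have hnonneg' : ∀ᵐ x, 0 ≤ ψ x := by
    filter_upwards [hnonneg, hψ] with x h1 h2 using h2 ▸ h1
  have hmono' : ∀ᵐ x, ∀ᵐ y, |x - x₀| ≤ |y - x₀| → ψ y ≤ ψ x := by
    filter_upwards [hmono, hψ] with x h1 h2
    filter_upwards [h1, hψ] with y h3 h4 h5
    rw [← h2, ← h4]
    exact h3 h5
  have hsupp' : ∀ᵐ x, x ∉ Icc (x₀ - 1) (x₀ + 1) → ψ x = 0 := by
    filter_upwards [hsupp, hψ] with x h1 h2 h3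
    rw [← h2]
    exact h1 fun h => h3 (Ioo_subset_Icc_self h)
  simp only [lineHeat_congr_ae hψ, dirichletHeat_congr_ae hψ]
  refine ⟨fun x hx hxR => exp_mul_lineHeat_le_dirichletHeat_right hl hr hψm hint' hnonneg' hmono'
    hsupp' ht hx hxR, fun x hxR hx => ?_⟩
  have hneg {p : ℝ → Prop} (h : ∀ᵐ x, p x) : ∀ᵐ x, p (-x) :=
    (Measure.measurePreserving_neg volume).quasiMeasurePreserving.ae h
  have habs : ∀ x, |x - -x₀| = |-x - x₀| := fun x => by
    rw [← abs_neg]; congr 1; ring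
  -- Reflection in the origin sends `x₀` to `-x₀`, which turns `d₁` into `d₂` and keeps `ℓ`.
  have h := exp_mul_lineHeat_le_dirichletHeat_right (R := R) (x₀ := -x₀) (x := -x) (t := t)
    (φ := fun y => ψ (-y)) (by linarith) (by linarith) (hψm.comp measurable_neg) hint'.comp_neg
    (hneg hnonneg') (by
      filter_upwards [hneg hmono'] with x h1
      filter_upwards [hneg h1] with y h2
      rw [habs, habs]
      exact h2) (by
      filter_upwards [hneg hsupp'] with x h1 h2
      exact h1 fun h => h2 ⟨by linarith [h.2], by linarith [h.1]⟩) ht (by linarith) (by linarith)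
  rw [dirichletHeat_comp_neg (by linarith), lineHeat_comp_neg, abs_neg, sub_neg_eq_add,
    sub_neg_eq_add] at h
  exact h
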